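/- Let $p>0$ be real and $E=E(1,1,p)=\{(z,w)\in\mathbb{C}^2 : |z|^2+|w|^{2p}<1\}$. Let $K(\zeta)=\sum_{j}|\varphi_j(\zeta)|^2$, where $(\varphi_j)_{j\in\mathbb{N}}$ is an orthonormal basis of the space $A^2(E)$ of holomorphic functions in $L^2(E)$, be the Bergman kernel of $E$ on the diagonal. With $z_1=z$, $z_2=w$, let $g_{i\bar j}=\dfrac{\partial^2\log K}{\partial z_i\,\partial\bar z_j}$ be the components of the Bergman metric $g$ of $E$, and let $\mathrm{Ric}_{i\bar j}=-\dfrac{\partial^2\log\det g}{\partial z_i\,\partial\bar z_j}$ be those of its Ricci tensor. Then $K$ is smooth and positive on $E$ and the matrix $(g_{i\bar j})$ is positive definite at every point of $E$. At every point $(z,w)\in E$ with $z$ real and $w=0$, $$\frac{\mathrm{Ric}_{1\bar 1}}{g_{1\bar 1}}=-1,\qquad \frac{\mathrm{Ric}_{2\bar 2}}{g_{2\bar 2}}=-\frac{2p^3+10p^2+10p+5}{(p+2)^2(2p+1)},$$ and at every such point these two ratios are equal if and only if $p=1$. Consequently, if $p\neq 1$, the Bergman metric is not Kähler–Einstein on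 $E$, i.e. there is no real constant $c$ with $\mathrm{Ric}=c\,g$ on $E$. It is not even asymptotically Kähler–Einstein: there is no real constant $c$ such that for every $\varepsilon>0$ there is a compact set $C\subset E$ with $|\mathrm{Ric}(v,v)-c\,g(v,v)|\le\varepsilon\, g(v,v)$ at all points of $E\setminus C$ and for all $v\in\mathbb{C}^2$, where $g(v,v)=\sum_{i,j} g_{i\bar j}v_i\overline{v_j}$ and $\mathrm{Ric}(v,v)=\sum_{i,j}\mathrm{Ric}_{i\bar j}v_i\overline{v_j}$. -/

import Mathlib

open MeasureTheory
open scoped ContDiff ComplexConjugate ComplexOrder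

noncomputable section

/-- The complex ellipsoid `E(1,1,p) = {(z, w) ∈ ℂ × ℂ : |z|² + |w|^{2p} < 1}`; the coordinates
`(z, w)` are `(ζ 0, ζ 1)`. -/
def ellipsoid (p : ℝ) : Set (Fin 2 → ℂ) :=
  {ζ | ‖ζ 0‖ ^ 2 + ‖ζ 1‖ ^ (2 * p) < 1}

/-- The Bergman space `A²(D)` of square integrable holomorphic functions on `D ⊆ ℂⁿ`
(Lebesgue measure), as a subspace of `L²(D)`. -/
def bergmanSpace {n : ℕ} (D : Set (Fin n → ℂ)) :
    Submodule ℂ (Lp ℂ 2 ((volume : Measure (Fin n → ℂ)).restrict D)) where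
  carrier := {f | ∃ F : (Fin n → ℂ) → ℂ, DifferentiableOn ℂ F D ∧
    f =ᵐ[(volume : Measure (Fin n → ℂ)).restrict D] F}
  zero_mem' := ⟨0, differentiableOn_const 0, Lp.coeFn_zero _ _ _⟩
  add_mem' := by
    rintro f g ⟨F, hF, hf⟩ ⟨G, hG, hg⟩
    exact ⟨F + G, hF.add hG, (Lp.coeFn_add f g).trans (hf.add hg)⟩
  smul_mem' := by
    rintro c f ⟨F, hF, hf⟩
    exact ⟨c • F, hF.const_smul c, (Lp.coeFn_smul c f).trans (hf.const_smul c)⟩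

/-- The holomorphic function on `D` (unique on `D` when `D` is open) that represents the class
`f ∈ A²(D)`. -/
def holoRep {n : ℕ} {D : Set (Fin n → ℂ)} (f : bergmanSpace D) : (Fin n → ℂ) → ℂ :=
  Classical.choose f.2

open Classical in
/-- The Bergman kernel on the diagonal, `K_D(ζ, ζ̄) = ∑ⱼ |φⱼ(ζ)|²`, where `(φⱼ)_{j ∈ ℕ}` is an
orthonormal (Hilbert) basis of `A²(D)`; for bounded open nonempty `D ⊆ ℂⁿ`, `n ≥ 1`, such a basis
exists and the sum does not depend on it. -/
def bergmanKernel {n : ℕ} (D : Set (Fin n → ℂ)) (ζ : Fin n → ℂ) : ℝ :=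
  if h : Nonempty (HilbertBasis ℕ ℂ (bergmanSpace D)) then
    ∑' j : ℕ, ‖holoRep (h.some j) ζ‖ ^ 2
  else 0

/-- The Wirtinger derivative `∂f/∂zᵢ = ½ (∂f/∂xᵢ - i ∂f/∂yᵢ)`. -/
def wirtinger {n : ℕ} (i : Fin n) (f : (Fin n → ℂ) → ℂ) (ζ : Fin n → ℂ) : ℂ :=
  (1 / 2) * (fderiv ℝ f ζ (Pi.single i 1) - Complex.I * fderiv ℝ f ζ (Pi.single i Complex.I))

/-- The Wirtinger derivative `∂f/∂z̄ᵢ = ½ (∂f/∂xᵢ + i ∂f/∂yᵢ)`. -/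
def wirtingerBar {n : ℕ} (i : Fin n) (f : (Fin n → ℂ) → ℂ) (ζ : Fin n → ℂ) : ℂ :=
  (1 / 2) * (fderiv ℝ f ζ (Pi.single i 1) + Complex.I * fderiv ℝ f ζ (Pi.single i Complex.I))

/-- The components `g_{ij̄} = ∂² log K_D / ∂zᵢ ∂z̄ⱼ` of the Bergman metric of `D`. -/
def bergmanMetric {n : ℕ} (D : Set (Fin n → ℂ)) (ζ : Fin n → ℂ) : Matrix (Fin n) (Fin n) ℂ :=
  Matrix.of fun i j =>
    wirtinger i (wirtingerBar j fun η => ((Real.log (bergmanKernel D η) : ℝ) : ℂ)) ζ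

/-- The components `Ric_{ij̄} = -∂² log det g / ∂zᵢ ∂z̄ⱼ` of the Ricci tensor of the Kähler metric
with components `g`. -/
def ricci {n : ℕ} (g : (Fin n → ℂ) → Matrix (Fin n) (Fin n) ℂ) (ζ : Fin n → ℂ) :
    Matrix (Fin n) (Fin n) ℂ :=
  Matrix.of fun i j => - wirtinger i (wirtingerBar j fun η => Complex.log (g η).det) ζ

/-- The value `∑_{i,j} Hᵢⱼ vᵢ v̄ⱼ` on `v` of the Hermitian form with components `H`. -/
def hermVal {n : ℕ} (H : Matrix (Fin n) (Fin n) ℂ) (v : Fin n → ℂ) : ℂ :=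
  ∑ i, ∑ j, H i j * v i * conj (v j)

/-- The Kähler metric `g` is Kähler–Einstein on `D`: `Ric = c g` on `D` with a real constant `c`. -/
def IsKaehlerEinstein {n : ℕ} (D : Set (Fin n → ℂ))
    (g : (Fin n → ℂ) → Matrix (Fin n) (Fin n) ℂ) : Prop :=
  ∃ c : ℝ, ∀ ζ ∈ D, ricci g ζ = (c : ℂ) • g ζ

/-- The Kähler metric `g` is asymptotically Kähler–Einstein on `D`: for some real constant `c`,
`Ric(v,v) / g(v,v)` tends to `c`, uniformly in `v ≠ 0`, as the point leaves every compact subset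
of `D`. -/
def IsAsymptoticallyKaehlerEinstein {n : ℕ} (D : Set (Fin n → ℂ))
    (g : (Fin n → ℂ) → Matrix (Fin n) (Fin n) ℂ) : Prop :=
  ∃ c : ℝ, ∀ ε : ℝ, 0 < ε → ∃ C : Set (Fin n → ℂ), IsCompact C ∧ C ⊆ D ∧
    ∀ ζ ∈ D \ C, ∀ v : Fin n → ℂ,
      ‖hermVal (ricci g ζ) v - (c : ℂ) * hermVal (g ζ) v‖ ≤ ε * ‖hermVal (g ζ) v‖

end

/-! Since `E` is invariant under rotation of each coordinate, the monomials `z ^ a * w ^ b` form a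
complete orthogonal system of `A²(E)`: pairing with one extracts a Taylor coefficient
(`inner_monomialClass`). Their norms are Beta integrals (`integral_ellipsoid_norm_pow`). Summing the
binomial series over `a` and geometric-type series over `b` gives the kernel in closed form
(`bergmanKernel_ellipsoid`), in terms of `q = 1 - |z|²` and `u = |w|² q ^ (-1/p)`, so that `log K =
const - (2 + 1/p) log q + L(u)`, `L(u) = log ((1 + p) + (1 - p) u) - 3 log (1 - u)`. The complex
Hessian of any such potential is computed once (`wirtinger_wirtingerBar_potential`). Its determinant
factors as `q ^ (-2 - 1/p) * Q * (2 + 1/p + P/p)`, with `P = u L'` and `Q = P'`. Hence `log det g`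
is again a potential of this shape, with the same coefficient `2 + 1/p` and another profile in `u`,
and the same Hessian formula yields the Ricci tensor.

On `w = 0` one has `u = 0`. The 11-entries of `g` and `-Ric` are then both `(2 + 1/p) / q²`, so that
ratio is `-1`. The ratio of the 22-entries depends only on the profiles at `0`, hence only on `p`,
and it equals `-1` exactly when `(p - 1)² = 0`. Both ratios are constant along a segment reaching
the boundary, so for `p ≠ 1` no single constant can serve, even asymptotically. -/

section BergmanKernel

open Metric Set Filter Topology

/-! ### Mean value inequality and uniform limits of holomorphic functions -/

/-- Rotating every coordinate by a unit complex number preserves Lebesgue measure. -/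
theorem measurePreserving_smul_circle {n : ℕ} (u : Circle) :
    MeasurePreserving (fun v : Fin n → ℂ => (u : ℂ) • v) volume volume := by
  have := volume_preserving_pi (fun _ : Fin n => (rotation u).measurePreserving)
  exact this

theorem smul_norm_sq_le_lintegral_circle {E : Type*} [NormedAddCommGroup E] [NormedSpace ℂ E]
    {F : E → ℂ} {x v : E} {r : ℝ} (hF : DifferentiableOn ℂ F (ball x r)) (hv : ‖v‖ < r) :
    ENNReal.ofReal (2 * Real.pi) * ‖F x‖ₑ ^ 2 ≤
      ∫⁻ θ in Ioc 0 (2 * Real.pi), ‖F (x + (Circle.exp θ : ℂ) • v)‖ₑ ^ 2 := by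
  -- The mean value property is applied to the holomorphic function `F²`, so taking norms bounds
  -- `|F(x)|²` by the circle average of `|F|²` without Jensen's inequality.
  have hd : DifferentiableOn ℂ (fun l : ℂ => F (x + l • v) ^ 2) (closedBall 0 1) := by
    refine (hF.comp (by fun_prop) ?_).pow 2
    intro l hl
    have hl' : ‖l‖ ≤ 1 := by simpa using hl
    rw [mem_ball, dist_eq_norm, add_sub_cancel_left, norm_smul]
    nlinarith [norm_nonneg v, norm_nonneg l]
  have hc : DiffContOnCl ℂ (fun l : ℂ => F (x + l • v) ^ 2) (ball 0 |1|) := by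
    rw [abs_one]
    exact hd.diffContOnCl_ball le_rfl
  have h := hc.circleAverage
  rw [Real.circleAverage_def, inv_smul_eq_iff₀ (by positivity),
    intervalIntegral.integral_of_le (by positivity)] at h
  calc ENNReal.ofReal (2 * Real.pi) * ‖F x‖ₑ ^ 2
      = ‖(2 * Real.pi) • F (x + (0 : ℂ) • v) ^ 2‖ₑ := by
        rw [enorm_smul, zero_smul, add_zero, enorm_pow, Real.enorm_of_nonneg (by positivity)]
    _ ≤ _ := by
        rw [← h]
        refine (enorm_integral_le_lintegral_enorm _).trans (le_of_eq ?_)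
        refine lintegral_congr fun θ => ?_
        rw [enorm_pow, circleMap_zero, Circle.coe_exp, Complex.ofReal_one, one_mul]

/-- The mean value inequality for `|F|²` over polydiscs. -/
theorem enorm_sq_mul_volume_ball_le {n : ℕ} {F : (Fin n → ℂ) → ℂ} {x : Fin n → ℂ} {r : ℝ}
    (hF : DifferentiableOn ℂ F (ball x r)) :
    ‖F x‖ₑ ^ 2 * volume (ball x r) ≤ ∫⁻ y in ball x r, ‖F y‖ₑ ^ 2 := by
  -- A unit scalar preserves volume and the sup-norm ball, so this integral does not depend on `θ`.
  -- Averaging over `θ` and swapping integrals then replaces any iterated radial integration.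
  have hrot (θ : ℝ) : ∫⁻ v in ball (0 : Fin n → ℂ) r, ‖F (x + (Circle.exp θ : ℂ) • v)‖ₑ ^ 2 =
      ∫⁻ y in ball x r, ‖F y‖ₑ ^ 2 := by
    have hm : MeasurePreserving (fun v : Fin n → ℂ => x + (Circle.exp θ : ℂ) • v) volume volume :=
      (measurePreserving_add_left volume x).comp (measurePreserving_smul_circle _)
    have he : MeasurableEmbedding (fun v : Fin n → ℂ => x + (Circle.exp θ : ℂ) • v) :=
      (Homeomorph.addLeft x).measurableEmbedding.comp
        (Homeomorph.smulOfNeZero (Circle.exp θ : ℂ) (by simp)).measurableEmbedding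
    rw [← hm.setLIntegral_comp_preimage_emb he (fun y => ‖F y‖ₑ ^ 2) (ball x r)]
    congr 2
    ext v
    simp [dist_eq_norm, norm_smul]
  have hmaps : MapsTo (fun q : (Fin n → ℂ) × ℝ => x + (Circle.exp q.2 : ℂ) • q.1)
      (ball 0 r ×ˢ Ioc 0 (2 * Real.pi)) (ball x r) := by
    rintro ⟨v, θ⟩ ⟨hv, -⟩
    simpa [dist_eq_norm, norm_smul] using hv
  have hmeas : AEMeasurable (fun q : (Fin n → ℂ) × ℝ =>
      ‖F (x + (Circle.exp q.2 : ℂ) • q.1)‖ₑ ^ 2)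
      ((volume.restrict (ball 0 r)).prod (volume.restrict (Ioc 0 (2 * Real.pi)))) := by
    rw [Measure.prod_restrict]
    have hc : ContinuousOn (fun q : (Fin n → ℂ) × ℝ => F (x + (Circle.exp q.2 : ℂ) • q.1))
        (ball 0 r ×ˢ Ioc 0 (2 * Real.pi)) :=
      hF.continuousOn.comp (by fun_prop) hmaps
    exact ((hc.aemeasurable (measurableSet_ball.prod measurableSet_Ioc)).enorm).pow_const 2
  have h2 : (0 : ENNReal) < ENNReal.ofReal (2 * Real.pi) := by
    rw [ENNReal.ofReal_pos]; positivity
  rw [← ENNReal.mul_le_mul_iff_right h2.ne' ENNReal.ofReal_ne_top]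
  calc ENNReal.ofReal (2 * Real.pi) * (‖F x‖ₑ ^ 2 * volume (ball x r))
      = ∫⁻ _ in ball (0 : Fin n → ℂ) r, ENNReal.ofReal (2 * Real.pi) * ‖F x‖ₑ ^ 2 := by
        rw [setLIntegral_const, ← mul_assoc, Measure.addHaar_ball_center]
    _ ≤ ∫⁻ v in ball (0 : Fin n → ℂ) r,
          ∫⁻ θ in Ioc 0 (2 * Real.pi), ‖F (x + (Circle.exp θ : ℂ) • v)‖ₑ ^ 2 :=
        setLIntegral_mono' measurableSet_ball fun v hv =>
          smul_norm_sq_le_lintegral_circle hF (by simpa using hv)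
    _ = ∫⁻ θ in Ioc 0 (2 * Real.pi), ∫⁻ v in ball (0 : Fin n → ℂ) r,
          ‖F (x + (Circle.exp θ : ℂ) • v)‖ₑ ^ 2 := lintegral_lintegral_swap hmeas
    _ = _ := by
        simp_rw [hrot]
        rw [setLIntegral_const, Real.volume_Ioc, sub_zero, mul_comm]

/-- A uniform limit of holomorphic functions on a ball is differentiable at the centre. -/
theorem differentiableAt_of_tendstoUniformlyOn_ball {E : Type*}
    [NormedAddCommGroup E] [NormedSpace ℂ E] {F : ℕ → E → ℂ} {f : E → ℂ} {x : E} {r : ℝ}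
    (hr : 0 < r) (hF : ∀ k, DifferentiableOn ℂ (F k) (ball x r))
    (h : TendstoUniformlyOn F f atTop (ball x r)) : DifferentiableAt ℂ f x := by
  have hd (k : ℕ) : ∀ y ∈ ball x r, DifferentiableAt ℂ (F k) y := fun y hy =>
    (hF k).differentiableAt (isOpen_ball.mem_nhds hy)
  have hsub : ∀ y ∈ ball x (r / 2), ball y (r / 2) ⊆ ball x r := fun y hy =>
    ball_subset_ball' (by linarith [mem_ball.1 hy])
  have hmem : ∀ y ∈ ball x (r / 2), y ∈ ball x r := fun y hy =>
    ball_subset_ball (by linarith) hy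
  -- `F m - F k` varies by at most `2 * (ε r / 8)` on a ball of radius `r / 2`, so the Schwarz lemma
  -- bounds its derivative at the centre by `ε / 2`.
  have hc : UniformCauchySeqOn (fun k => fderiv ℂ (F k)) atTop (ball x (r / 2)) := by
    rw [Metric.uniformCauchySeqOn_iff]
    intro ε hε
    obtain ⟨N, hN⟩ := Metric.uniformCauchySeqOn_iff.1 h.uniformCauchySeqOn (ε * r / 8)
      (by positivity)
    refine ⟨N, fun m hm k hk y hy => ?_⟩
    have hb : ∀ w ∈ ball x r, ‖F m w - F k w‖ < ε * r / 8 := fun w hw => by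
      rw [← dist_eq_norm]; exact hN m hm k hk w hw
    rw [dist_eq_norm, ← fderiv_fun_sub (hd m y (hmem y hy)) (hd k y (hmem y hy))]
    refine (Complex.norm_fderiv_le_div_of_mapsTo_ball (R₁ := r / 2) (R₂ := ε * r / 4)
      (((hF m).sub (hF k)).mono (hsub y hy)) (fun w hw => ?_) (by positivity)).trans_lt ?_
    · rw [mem_closedBall, dist_eq_norm]
      refine (norm_sub_le _ _).trans ?_
      have h1 := hb w (hsub y hy hw)
      have h2 := hb y (hmem y hy)
      simp only [Pi.sub_apply]
      linarith
    · rw [div_lt_iff₀ (by positivity)]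
      nlinarith [mul_pos hε hr]
  choose! g' hg' using fun y (hy : y ∈ ball x (r / 2)) =>
    cauchySeq_tendsto_of_complete (hc.cauchySeq hy)
  exact (hasFDerivAt_of_tendstoUniformlyOn isOpen_ball (hc.tendstoUniformlyOn_of_tendsto hg')
    (fun k y hy => (hd k y (hmem y hy)).hasFDerivAt)
    (fun y hy => h.tendsto_at (hmem y hy)) (mem_ball_self (by positivity))).differentiableAt

/-! ### The Bergman space: evaluations, completeness, independence of the basis -/

section BergmanSpace

variable {n : ℕ} {D : Set (Fin n → ℂ)}

theorem differentiableOn_holoRep (f : bergmanSpace D) : DifferentiableOn ℂ (holoRep f) D :=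
  (Classical.choose_spec f.2).1

theorem coeFn_ae_eq_holoRep (f : bergmanSpace D) :
    (f : Lp ℂ 2 ((volume : Measure (Fin n → ℂ)).restrict D)) =ᵐ[volume.restrict D] holoRep f :=
  (Classical.choose_spec f.2).2

theorem holoRep_eqOn (hD : IsOpen D) {f : bergmanSpace D} {F : (Fin n → ℂ) → ℂ}
    (hF : ContinuousOn F D)
    (h : (f : Lp ℂ 2 ((volume : Measure (Fin n → ℂ)).restrict D)) =ᵐ[volume.restrict D] F) :
    EqOn (holoRep f) F D :=
  Measure.eqOn_open_of_ae_eq ((coeFn_ae_eq_holoRep f).symm.trans h) hD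
    (differentiableOn_holoRep f).continuousOn hF

theorem holoRep_add (hD : IsOpen D) (f g : bergmanSpace D) :
    EqOn (holoRep (f + g)) (holoRep f + holoRep g) D :=
  holoRep_eqOn hD
    ((differentiableOn_holoRep f).add (differentiableOn_holoRep g)).continuousOn
    ((Lp.coeFn_add _ _).trans ((coeFn_ae_eq_holoRep f).add (coeFn_ae_eq_holoRep g)))

theorem holoRep_smul (hD : IsOpen D) (c : ℂ) (f : bergmanSpace D) :
    EqOn (holoRep (c • f)) (c • holoRep f) D :=
  holoRep_eqOn hD ((differentiableOn_holoRep f).const_smul c).continuousOn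
    ((Lp.coeFn_smul _ _).trans ((coeFn_ae_eq_holoRep f).const_smul c))

/-- Point evaluations are bounded on the Bergman space, locally uniformly. -/
theorem exists_norm_holoRep_le (hD : IsOpen D) {x : Fin n → ℂ} (hx : x ∈ D) :
    ∃ r > 0, ball x r ⊆ D ∧ ∃ C : ℝ, ∀ y ∈ ball x r, ∀ f : bergmanSpace D,
      ‖holoRep f y‖ ≤ C * ‖f‖ := by
  obtain ⟨r, hr, hrD⟩ := Metric.isOpen_iff.1 hD x hx
  have hr2 : 0 < r / 2 := by positivity
  have hV0 : volume (ball x (r / 2)) ≠ 0 := (measure_ball_pos volume x hr2).ne'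
  have hVt : volume (ball x (r / 2)) ≠ ⊤ := measure_ball_lt_top.ne
  set V := (volume (ball x (r / 2))).toReal with hV
  have hVpos : 0 < V := ENNReal.toReal_pos hV0 hVt
  -- Balls of radius `r / 2` about the points of `ball x (r / 2)` stay in `D` and share the volume
  -- `V`, which makes the constant uniform.
  refine ⟨r / 2, hr2, (ball_subset_ball (by linarith)).trans hrD, (Real.sqrt V)⁻¹,
    fun y hy f => ?_⟩
  have hyD : ball y (r / 2) ⊆ D :=
    (ball_subset_ball' (by linarith [mem_ball.1 hy])).trans hrD
  have h1 : ‖holoRep f y‖ₑ ^ 2 * volume (ball x (r / 2)) ≤ ‖f‖ₑ ^ 2 := by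
    rw [Measure.addHaar_ball_center, ← Measure.addHaar_ball_center volume y]
    calc _ ≤ ∫⁻ w in ball y (r / 2), ‖holoRep f w‖ₑ ^ 2 :=
          enorm_sq_mul_volume_ball_le ((differentiableOn_holoRep f).mono hyD)
      _ ≤ ∫⁻ w in D, ‖holoRep f w‖ₑ ^ 2 := lintegral_mono_set hyD
      _ = ∫⁻ w in D, ‖(f : Lp ℂ 2 ((volume : Measure (Fin n → ℂ)).restrict D)) w‖ₑ ^ 2 :=
          lintegral_congr_ae ((coeFn_ae_eq_holoRep f).mono fun w hw => by simp only [hw])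
      _ = ‖f‖ₑ ^ 2 := by
          have h := eLpNorm_nnreal_pow_eq_lintegral (p := 2)
            (f := ((f : Lp ℂ 2 ((volume : Measure (Fin n → ℂ)).restrict D)) :
              (Fin n → ℂ) → ℂ)) (μ := volume.restrict D) two_ne_zero
          have h' := Lp.enorm_def (f : Lp ℂ 2 ((volume : Measure (Fin n → ℂ)).restrict D))
          simp only [NNReal.coe_ofNat, ENNReal.rpow_ofNat, ENNReal.coe_ofNat] at h
          rw [← h, ← h']
          rfl
  have h2 := ENNReal.toReal_mono (by simp) h1
  rw [ENNReal.toReal_mul, ENNReal.toReal_pow, ENNReal.toReal_pow, toReal_enorm, toReal_enorm,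
    ← hV] at h2
  rw [inv_mul_eq_div, le_div_iff₀ (Real.sqrt_pos.2 hVpos)]
  refine abs_le_of_sq_le_sq' ?_ (norm_nonneg _) |>.2
  rwa [mul_pow, Real.sq_sqrt hVpos.le]

/-- By the locally uniform bound on evaluations, an `L²` Cauchy sequence is locally uniformly Cauchy
as functions. The pointwise limit is therefore holomorphic, and an almost everywhere convergent
subsequence identifies it with the `L²` limit. Completeness is what the Riesz representation of
evaluations requires. -/
theorem completeSpace_bergmanSpace (hD : IsOpen D) : CompleteSpace (bergmanSpace D) := by
  refine completeSpace_coe_iff_isComplete.2 (IsClosed.isComplete ?_)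
  refine IsSeqClosed.isClosed fun u f hu hf => ?_
  set v : ℕ → bergmanSpace D := fun k => ⟨u k, hu k⟩ with hv
  have hvc : CauchySeq v := by
    have := hf.cauchySeq
    rw [Metric.cauchySeq_iff] at this ⊢
    exact this
  have hloc : ∀ x ∈ D, ∃ r > 0, ball x r ⊆ D ∧
      UniformCauchySeqOn (fun k => holoRep (v k)) atTop (ball x r) := by
    intro x hx
    obtain ⟨r, hr, hrD, C, hC⟩ := exists_norm_holoRep_le hD hx
    refine ⟨r, hr, hrD, Metric.uniformCauchySeqOn_iff.2 fun ε hε => ?_⟩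
    obtain ⟨N, hN⟩ := Metric.cauchySeq_iff.1 hvc (ε / (|C| + 1)) (by positivity)
    refine ⟨N, fun m hm k hk y hy => ?_⟩
    have h1 : holoRep (v m) y - holoRep (v k) y = holoRep (v m + (-1 : ℂ) • v k) y := by
      rw [holoRep_add hD _ _ (hrD hy), Pi.add_apply, holoRep_smul hD _ _ (hrD hy)]
      simp [sub_eq_add_neg]
    have h2 : ‖v m + (-1 : ℂ) • v k‖ < ε / (|C| + 1) := by
      have := hN m hm k hk
      rwa [dist_eq_norm, sub_eq_add_neg, ← neg_one_smul ℂ] at this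
    rw [dist_eq_norm, h1]
    refine (hC y hy _).trans_lt ?_
    rw [lt_div_iff₀ (by positivity)] at h2
    nlinarith [le_abs_self C, norm_nonneg (v m + (-1 : ℂ) • v k)]
  have hlim : ∀ x ∈ D, ∃ y, Tendsto (fun k => holoRep (v k) x) atTop (𝓝 y) := by
    intro x hx
    obtain ⟨r, hr, -, hc⟩ := hloc x hx
    exact cauchySeq_tendsto_of_complete (hc.cauchySeq (mem_ball_self hr))
  choose! F hF using hlim
  refine ⟨F, fun x hx => ?_, ?_⟩
  · obtain ⟨r, hr, hrD, hc⟩ := hloc x hx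
    exact (differentiableAt_of_tendstoUniformlyOn_ball hr
      (fun k => (differentiableOn_holoRep (v k)).mono hrD)
      (hc.tendstoUniformlyOn_of_tendsto fun y hy => hF y (hrD hy))).differentiableWithinAt
  · obtain ⟨s, hs, hsf⟩ := (tendstoInMeasure_of_tendsto_Lp hf).exists_seq_tendsto_ae
    have hall : ∀ᵐ x ∂volume.restrict D, ∀ k, u k x = holoRep (v k) x :=
      ae_all_iff.2 fun k => coeFn_ae_eq_holoRep (v k)
    filter_upwards [hsf, hall, ae_restrict_mem hD.measurableSet] with x h1 h2 h3
    refine tendsto_nhds_unique h1 ?_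
    simp_rw [h2]
    exact (hF x h3).comp hs.tendsto_atTop

/-- Evaluation at a point of `D` as a bounded functional on the Bergman space. -/
theorem exists_clm_eq_holoRep (hD : IsOpen D) {x : Fin n → ℂ} (hx : x ∈ D) :
    ∃ e : bergmanSpace D →L[ℂ] ℂ, ∀ f, e f = holoRep f x := by
  obtain ⟨r, hr, -, C, hC⟩ := exists_norm_holoRep_le hD hx
  exact ⟨LinearMap.mkContinuous
    { toFun := fun f => holoRep f x
      map_add' := fun f g => holoRep_add hD f g hx
      map_smul' := fun c f => holoRep_smul hD c f hx } C fun f => hC x (mem_ball_self hr) f,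
    fun f => rfl⟩

/-- The Bergman kernel on the diagonal can be computed from any Hilbert basis. -/
theorem exists_hasSum_norm_sq_holoRep (hD : IsOpen D) {x : Fin n → ℂ} (hx : x ∈ D) :
    ∃ K : ℝ, ∀ (ι : Type) (b : HilbertBasis ι ℂ (bergmanSpace D)),
      HasSum (fun i => ‖holoRep (b i) x‖ ^ 2) K := by
  have := completeSpace_bergmanSpace hD
  obtain ⟨e, he⟩ := exists_clm_eq_holoRep hD hx
  -- `k` is the Riesz representative of evaluation at `x`; Parseval's identity gives `‖k‖²` in every
  -- basis.
  set k := (InnerProductSpace.toDual ℂ (bergmanSpace D)).symm e with hk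
  have hke : ∀ f, inner ℂ k f = holoRep f x := fun f => by
    rw [hk, InnerProductSpace.toDual_symm_apply, he]
  refine ⟨‖k‖ ^ 2, fun ι b => ?_⟩
  have h := Complex.hasSum_re (b.hasSum_inner_mul_inner k k)
  convert h using 1
  · ext i
    rw [← inner_conj_symm (b i) k, hke, Complex.mul_conj, Complex.ofReal_re,
      Complex.normSq_eq_norm_sq]
  · rw [inner_self_eq_norm_sq_to_K]
    norm_cast

/-- Reindexing `b` by `ℕ` shows that the definition is not in its default branch; the value then
agrees with the one from `b` by independence of the basis. -/
theorem bergmanKernel_eq_tsum (hD : IsOpen D) {ι : Type} [Infinite ι] [Countable ι]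
    (b : HilbertBasis ι ℂ (bergmanSpace D)) {x : Fin n → ℂ} (hx : x ∈ D) :
    HasSum (fun i => ‖holoRep (b i) x‖ ^ 2) (bergmanKernel D x) := by
  have := completeSpace_bergmanSpace hD
  obtain ⟨e⟩ : Nonempty (ℕ ≃ ι) := by
    have := Encodable.ofCountable ι
    have := Denumerable.ofEncodableOfInfinite ι
    exact ⟨(Denumerable.eqv ι).symm⟩
  have hne : Nonempty (HilbertBasis ℕ ℂ (bergmanSpace D)) := by
    refine ⟨HilbertBasis.mk (v := b ∘ e) (b.orthonormal.comp e e.injective) ?_⟩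
    rw [Set.range_comp, e.surjective.range_eq, Set.image_univ, b.dense_span]
  obtain ⟨K, hK⟩ := exists_hasSum_norm_sq_holoRep hD hx
  rw [bergmanKernel, dif_pos hne, (hK ℕ hne.some).tsum_eq]
  exact hK ι b

end BergmanSpace

/-! ### Rotation averages and Taylor coefficients -/

/-- Averaging an integrable function over a one-parameter family of measure preserving maps. -/
theorem integral_integral_comp_measurePreserving {X : Type*} [MeasurableSpace X] {μ : Measure X}
    [SFinite μ] {T : ℝ → X → X} (hT : Measurable (Function.uncurry T))
    (hmp : ∀ θ, MeasurePreserving (T θ) μ μ) {g : X → ℂ} (hg : Integrable g μ) :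
    Integrable (fun x => ∫ θ in 0..2 * Real.pi, g (T θ x)) μ ∧
      ∫ x, (∫ θ in 0..2 * Real.pi, g (T θ x)) ∂μ = 2 * Real.pi * ∫ x, g x ∂μ := by
  simp_rw [intervalIntegral.integral_of_le Real.two_pi_pos.le]
  set ν : Measure ℝ := volume.restrict (Ioc 0 (2 * Real.pi)) with hν
  -- The skew product preserves the product measure, which gives the joint integrability needed for
  -- Fubini.
  have hskew : MeasurePreserving (fun q : ℝ × X => (q.1, T q.1 q.2)) (ν.prod μ) (ν.prod μ) :=
    (MeasurePreserving.id ν).skew_product hT (ae_of_all _ fun θ => (hmp θ).map_eq)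
  have hint : Integrable (fun q : ℝ × X => g (T q.1 q.2)) (ν.prod μ) :=
    hskew.integrable_comp_of_integrable (hg.comp_snd ν)
  refine ⟨hint.integral_prod_right, ?_⟩
  rw [integral_integral_swap (f := fun x θ => g (T θ x)) hint.swap]
  have hconst (θ : ℝ) : ∫ x, g (T θ x) ∂μ = ∫ x, g x ∂μ := by
    have h := integral_map (φ := T θ) (μ := μ) (f := g) (hmp θ).measurable.aemeasurable
      (by rw [(hmp θ).map_eq]; exact hg.aestronglyMeasurable)
    rw [(hmp θ).map_eq] at h
    exact h.symm
  simp_rw [hconst]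
  simp [hν, Real.two_pi_pos.le]

/-- The `b`-th Taylor coefficient of `H` at the origin. -/
noncomputable def taylorCoeff (b : ℕ) (H : ℂ → ℂ) : ℂ :=
  (b.factorial : ℂ)⁻¹ * iteratedDeriv b H 0

theorem iteratedDeriv_comp_mul_const_zero {H : ℂ → ℂ} {R : ℝ} (hR : 0 < R)
    (hH : DifferentiableOn ℂ H (ball 0 R)) (w : ℂ) (b : ℕ) :
    iteratedDeriv b (fun l => H (l * w)) 0 = w ^ b * iteratedDeriv b H 0 := by
  set g : ℂ →L[ℂ] ℂ := (ContinuousLinearMap.mul ℂ ℂ).flip w with hg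
  have hgo : IsOpen (g ⁻¹' ball 0 R) := isOpen_ball.preimage g.continuous
  have h := g.iteratedFDerivWithin_comp_right (n := ⊤) (hH.contDiffOn isOpen_ball)
    isOpen_ball.uniqueDiffOn hgo.uniqueDiffOn (x := 0) (by simpa using hR) (i := b) le_top
  rw [iteratedFDerivWithin_of_isOpen b hgo (by simpa using hR),
    iteratedFDerivWithin_of_isOpen b isOpen_ball (by simpa using hR)] at h
  have h2 := congrArg (fun M => M (fun _ => (1 : ℂ))) h
  simp only [ContinuousMultilinearMap.compContinuousLinearMap_apply,
    iteratedFDeriv_apply_eq_iteratedDeriv_mul_prod] at h2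
  simpa [hg, Function.comp_def, mul_comm] using h2

/-- Cauchy's formula for the derivatives of `l ↦ H (l * w)` on the unit circle, where conjugation is
inversion. Scaling by `w` instead of integrating over the circle of radius `‖w‖` includes `w = 0`.
-/
theorem integral_exp_mul_rotation {H : ℂ → ℂ} {R : ℝ} (hH : DifferentiableOn ℂ H (ball 0 R))
    {w : ℂ} (hw : w ∈ ball 0 R) (b : ℕ) :
    ∫ θ in 0..2 * Real.pi, conj (Circle.exp θ : ℂ) ^ b * H (Circle.exp θ * w) =
      2 * Real.pi * (taylorCoeff b H * w ^ b) := by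
  have hw' : ‖w‖ < R := by simpa using hw
  have hd : DifferentiableOn ℂ (fun l : ℂ => H (l * w)) (closedBall 0 1) := by
    refine hH.comp (by fun_prop) fun l hl => ?_
    have hl' : ‖l‖ ≤ 1 := by simpa using hl
    rw [mem_ball_zero_iff, norm_mul]
    nlinarith [norm_nonneg w, norm_nonneg l]
  have h := hd.circleIntegral_one_div_sub_center_pow_smul one_pos b
  rw [iteratedDeriv_comp_mul_const_zero ((norm_nonneg w).trans_lt hw') hH, circleIntegral] at h
  have hI : Complex.I ≠ 0 := Complex.I_ne_zero
  rw [← mul_right_inj' hI, ← intervalIntegral.integral_const_mul]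
  convert h using 1
  · refine intervalIntegral.integral_congr fun θ _ => ?_
    have he : (Circle.exp θ : ℂ) ≠ 0 := by simp
    have hc : conj (Circle.exp θ : ℂ) = (Circle.exp θ : ℂ)⁻¹ := by
      rw [← Circle.coe_inv_eq_conj, Circle.coe_inv]
    have hm : circleMap 0 1 θ = Circle.exp θ := by simp [circleMap, Circle.coe_exp]
    simp only [deriv_circleMap, hm, hc, smul_eq_mul, sub_zero]
    field_simp
    rw [one_div, inv_pow]
    field_simp
    ring
  · rw [taylorCoeff, smul_eq_mul]
    ring

theorem eq_zero_of_taylorCoeff_eq_zero {H : ℂ → ℂ} {R : ℝ} (hH : DifferentiableOn ℂ H (ball 0 R))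
    (h : ∀ b, taylorCoeff b H = 0) {w : ℂ} (hw : w ∈ ball 0 R) : H w = 0 := by
  rw [← Complex.taylorSeries_eq_on_ball' hw hH]
  simp_rw [taylorCoeff] at h
  simp [h]

/-- The monomials are their own Taylor expansions. -/
theorem taylorCoeff_const_mul_pow (a b : ℕ) (c : ℂ) :
    taylorCoeff b (fun z => c * z ^ a) = if a = b then c else 0 := by
  rw [taylorCoeff, iteratedDeriv_const_mul_field, iteratedDeriv_fun_pow_zero]
  split_ifs with h h' h'
  · subst h
    have := Nat.factorial_ne_zero b
    field_simp
  · exact absurd h.symm h'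
  · exact absurd h'.symm h
  · simp

/-- Circle averages in the second variable depend holomorphically on the first one. -/
theorem differentiableAt_integral_exp_mul {D : Set (Fin 2 → ℂ)} (hD : IsOpen D)
    {f : (Fin 2 → ℂ) → ℂ} (hf : DifferentiableOn ℂ f D) {z₀ w : ℂ} {r : ℝ} (hr : 0 < r)
    (h : ∀ z ∈ ball z₀ r, ∀ θ : ℝ, ![z, Circle.exp θ * w] ∈ D) (b : ℕ) :
    DifferentiableAt ℂ (fun z => ∫ θ in 0..2 * Real.pi,
      conj (Circle.exp θ : ℂ) ^ b * f ![z, Circle.exp θ * w]) z₀ := by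
  have hvec : Continuous fun q : ℂ × ℝ => (![q.1, (Circle.exp q.2 : ℂ) * w] : Fin 2 → ℂ) := by
    fun_prop
  have hslice (θ : ℝ) : ∀ z ∈ ball z₀ r, HasDerivAt (fun z => f ![z, Circle.exp θ * w])
      (fderiv ℂ f ![z, Circle.exp θ * w] (Pi.single 0 1)) z := by
    intro z hz
    have h1 := (hf.differentiableAt (hD.mem_nhds (h z hz θ))).hasFDerivAt
    refine h1.comp_hasDerivAt z ?_
    rw [hasDerivAt_pi]
    intro i
    fin_cases i
    · simpa using hasDerivAt_id' z
    · simpa using hasDerivAt_const z _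
  obtain ⟨M, hM⟩ : ∃ M, ∀ z ∈ closedBall z₀ (r / 2), ∀ θ ∈ Icc 0 (2 * Real.pi),
      ‖f ![z, Circle.exp θ * w]‖ ≤ M := by
    have hK : IsCompact (closedBall z₀ (r / 2) ×ˢ Icc 0 (2 * Real.pi)) :=
      (isCompact_closedBall _ _).prod isCompact_Icc
    obtain ⟨M, hM⟩ := hK.exists_bound_of_continuousOn
      (f := fun q : ℂ × ℝ => f ![q.1, (Circle.exp q.2 : ℂ) * w])
      (hf.continuousOn.comp hvec.continuousOn fun q hq =>
        h q.1 (closedBall_subset_ball (by linarith) hq.1) q.2)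
    exact ⟨M, fun z hz θ hθ => hM (z, θ) ⟨hz, hθ⟩⟩
  have hcont : ∀ z ∈ ball z₀ r, Continuous fun θ : ℝ =>
      conj (Circle.exp θ : ℂ) ^ b * f ![z, Circle.exp θ * w] := by
    intro z hz
    refine Continuous.mul (by fun_prop) ?_
    exact hf.continuousOn.comp_continuous (hvec.comp (Continuous.prodMk_right z)) (h z hz)
  have hnorm (θ : ℝ) : ‖conj (Circle.exp θ : ℂ) ^ b‖ = 1 := by simp
  -- The bound `M / (r / 4)` is Cauchy's estimate: discs of radius `r / 4` about points of `ball z₀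
  -- (r / 4)` remain in the closed ball of radius `r / 2`, where `|f| ≤ M`.
  refine (intervalIntegral.hasDerivAt_integral_of_dominated_loc_of_deriv_le
    (F' := fun z θ => conj (Circle.exp θ : ℂ) ^ b *
      fderiv ℂ f ![z, Circle.exp θ * w] (Pi.single 0 1))
    (bound := fun _ => M / (r / 4)) (s := ball z₀ (r / 4)) (ball_mem_nhds _ (by positivity))
    ?_ ?_ ?_ ?_ ?_ ?_).2.differentiableAt
  · filter_upwards [ball_mem_nhds z₀ hr] with z hz
    exact (hcont z hz).aestronglyMeasurable
  · exact (hcont z₀ (mem_ball_self hr)).intervalIntegrable _ _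
  · refine Measurable.aestronglyMeasurable ?_
    refine Measurable.mul (by fun_prop) ?_
    exact (measurable_fderiv_apply_const ℂ f (Pi.single 0 1)).comp
      (hvec.comp (Continuous.prodMk_right z₀)).measurable
  · refine ae_of_all _ fun θ hθ z hz => ?_
    rw [uIoc_of_le Real.two_pi_pos.le] at hθ
    have hsub : closedBall z (r / 4) ⊆ closedBall z₀ (r / 2) :=
      closedBall_subset_closedBall' (by linarith [mem_ball.1 hz])
    have hsub' : closedBall z₀ (r / 2) ⊆ ball z₀ r := closedBall_subset_ball (by linarith)
    have hz' : z ∈ ball z₀ r := ball_subset_ball (by linarith) hz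
    rw [norm_mul, hnorm, one_mul, ← (hslice θ z hz').deriv]
    refine Complex.norm_deriv_le_of_forall_mem_sphere_norm_le (by positivity) ?_ fun y hy =>
      hM y (hsub (sphere_subset_closedBall hy)) θ (Ioc_subset_Icc_self hθ)
    refine DifferentiableOn.diffContOnCl_ball (U := ball z₀ r) (fun y hy => ?_)
      (hsub.trans hsub')
    exact (hslice θ y hy).differentiableAt.differentiableWithinAt
  · exact intervalIntegrable_const
  · refine ae_of_all _ fun θ _ z hz => ?_
    exact (hslice θ z (ball_subset_ball (by linarith) hz)).const_mul _

/-! ### Geometry of the ellipsoid and Taylor coefficients in two variables -/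

section Ellipsoid

variable {p : ℝ}

theorem isOpen_ellipsoid (hp : 0 < p) : IsOpen (ellipsoid p) := by
  refine isOpen_lt ?_ continuous_const
  refine Continuous.add (by fun_prop) ?_
  exact Continuous.rpow_const (by fun_prop) fun _ => Or.inr (by positivity)

theorem norm_zero_lt_one_of_mem_ellipsoid {ζ : Fin 2 → ℂ} (h : ζ ∈ ellipsoid p) : ‖ζ 0‖ < 1 := by
  have h1 : ‖ζ 0‖ ^ 2 + ‖ζ 1‖ ^ (2 * p) < 1 := h
  have h2 : 0 ≤ ‖ζ 1‖ ^ (2 * p) := by positivity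
  nlinarith [norm_nonneg (ζ 0)]

/-- The slices of the ellipsoid are discs. -/
theorem mem_ellipsoid_iff (hp : 0 < p) {z w : ℂ} (hz : ‖z‖ < 1) :
    ![z, w] ∈ ellipsoid p ↔ w ∈ ball (0 : ℂ) ((1 - ‖z‖ ^ 2) ^ (1 / (2 * p))) := by
  have h0 : 0 < 1 - ‖z‖ ^ 2 := by nlinarith [norm_nonneg z]
  have h1 : ![z, w] ∈ ellipsoid p ↔ ‖z‖ ^ 2 + ‖w‖ ^ (2 * p) < 1 := by simp [ellipsoid]
  rw [h1, mem_ball_zero_iff, one_div, Real.lt_rpow_inv_iff_of_pos (norm_nonneg w) h0.le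
    (by positivity), lt_sub_iff_add_lt']

theorem norm_one_lt_one_of_mem_ellipsoid (hp : 0 < p) {ζ : Fin 2 → ℂ} (h : ζ ∈ ellipsoid p) :
    ‖ζ 1‖ < 1 := by
  have h1 : ‖ζ 0‖ ^ 2 + ‖ζ 1‖ ^ (2 * p) < 1 := h
  by_contra! hc
  have := Real.one_le_rpow hc (by positivity : 0 ≤ 2 * p)
  nlinarith [norm_nonneg (ζ 0)]

theorem ellipsoid_subset_ball (hp : 0 < p) : ellipsoid p ⊆ ball 0 1 := by
  intro ζ h
  rw [mem_ball_zero_iff, pi_norm_lt_iff one_pos]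
  intro i
  fin_cases i
  exacts [norm_zero_lt_one_of_mem_ellipsoid h, norm_one_lt_one_of_mem_ellipsoid hp h]

theorem volume_ellipsoid_lt_top (hp : 0 < p) : volume (ellipsoid p) < ⊤ :=
  (measure_mono (ellipsoid_subset_ball hp)).trans_lt measure_ball_lt_top

/-- The ellipsoid is invariant under rotations of a coordinate. -/
theorem measurePreserving_update_ellipsoid (hp : 0 < p) (i : Fin 2) (u : Circle) :
    MeasurePreserving (fun ζ : Fin 2 → ℂ => Function.update ζ i (u * ζ i))
      (volume.restrict (ellipsoid p)) (volume.restrict (ellipsoid p)) := by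
  have h := volume_preserving_pi (fun j : Fin 2 =>
    (rotation (if j = i then u else 1)).measurePreserving)
  have he : (fun ζ : Fin 2 → ℂ => Function.update ζ i (u * ζ i)) =
      fun ζ j => rotation (if j = i then u else 1) (ζ j) := by
    ext ζ j
    by_cases hj : j = i
    · subst hj; simp
    · simp [hj]
  have hpre : (fun (ζ : Fin 2 → ℂ) j => rotation (if j = i then u else 1) (ζ j)) ⁻¹'
      ellipsoid p = ellipsoid p := by
    ext ζ
    simp [ellipsoid, Circle.norm_coe]
  have h' := h.restrict_preimage (isOpen_ellipsoid hp).measurableSet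
  rw [hpre] at h'
  rw [he]
  exact h'

/-- The monomial `z ^ a * w ^ b`. -/
def monomialFun (a b : ℕ) (ζ : Fin 2 → ℂ) : ℂ := ζ 0 ^ a * ζ 1 ^ b

theorem continuous_monomialFun (a b : ℕ) : Continuous (monomialFun a b) := by
  unfold monomialFun; fun_prop

theorem differentiable_monomialFun (a b : ℕ) : Differentiable ℂ (monomialFun a b) := by
  unfold monomialFun; fun_prop

theorem norm_monomialFun_le_one (hp : 0 < p) (a b : ℕ) {ζ : Fin 2 → ℂ} (h : ζ ∈ ellipsoid p) :
    ‖monomialFun a b ζ‖ ≤ 1 := by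
  rw [monomialFun, norm_mul, norm_pow, norm_pow]
  exact mul_le_one₀ (pow_le_one₀ (norm_nonneg _) (norm_zero_lt_one_of_mem_ellipsoid h).le)
    (by positivity) (pow_le_one₀ (norm_nonneg _) (norm_one_lt_one_of_mem_ellipsoid hp h).le)

variable {f : (Fin 2 → ℂ) → ℂ}

theorem differentiableOn_slice (hp : 0 < p) (hf : DifferentiableOn ℂ f (ellipsoid p)) {z : ℂ}
    (hz : ‖z‖ < 1) :
    DifferentiableOn ℂ (fun w => f ![z, w]) (ball 0 ((1 - ‖z‖ ^ 2) ^ (1 / (2 * p)))) := by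
  refine hf.comp (fun w _ => DifferentiableAt.differentiableWithinAt ?_)
    fun w hw => (mem_ellipsoid_iff hp hz).2 hw
  rw [differentiableAt_pi]
  intro i
  fin_cases i <;> simp

theorem update_one_eq (ζ : Fin 2 → ℂ) (w : ℂ) : Function.update ζ 1 w = ![ζ 0, w] := by
  ext i; fin_cases i <;> simp

theorem update_zero_eq (ζ : Fin 2 → ℂ) (z : ℂ) : Function.update ζ 0 z = ![z, ζ 1] := by
  ext i; fin_cases i <;> simp

theorem slice_mem_ball (hp : 0 < p) {ζ : Fin 2 → ℂ} (h : ζ ∈ ellipsoid p) :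
    ζ 1 ∈ ball (0 : ℂ) ((1 - ‖ζ 0‖ ^ 2) ^ (1 / (2 * p))) := by
  rw [← mem_ellipsoid_iff hp (norm_zero_lt_one_of_mem_ellipsoid h), ← update_one_eq,
    Function.update_eq_self]
  exact h

/-- The Taylor coefficients in the second variable are holomorphic in the first variable. -/
theorem differentiableOn_taylorCoeff_slice (hp : 0 < p) (hf : DifferentiableOn ℂ f (ellipsoid p))
    (b : ℕ) : DifferentiableOn ℂ (fun z => taylorCoeff b fun w => f ![z, w]) (ball 0 1) := by
  intro z₀ hz₀
  rw [mem_ball_zero_iff] at hz₀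
  have h0 : 0 < 1 - ‖z₀‖ ^ 2 := by nlinarith [norm_nonneg z₀]
  -- Half the slice radius: `w` is nonzero, so one can divide by `w ^ b`, and it lies in the slices
  -- over all `z` near `z₀`.
  set w : ℂ := ((((1 - ‖z₀‖ ^ 2) ^ (1 / (2 * p))) / 2 : ℝ) : ℂ) with hw
  have hR : 0 < (1 - ‖z₀‖ ^ 2) ^ (1 / (2 * p)) := by positivity
  have hw0 : w ≠ 0 := by
    rw [hw, Complex.ofReal_ne_zero]; positivity
  have hmem : ![z₀, w] ∈ ellipsoid p := by
    rw [mem_ellipsoid_iff hp hz₀, mem_ball_zero_iff, hw, Complex.norm_real, Real.norm_of_nonneg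
      (by positivity)]
    linarith
  have hopen : IsOpen {z : ℂ | ![z, w] ∈ ellipsoid p} :=
    (isOpen_ellipsoid hp).preimage (by fun_prop)
  obtain ⟨r, hr, hrE⟩ := Metric.isOpen_iff.1 hopen z₀ hmem
  have hrot : ∀ z ∈ ball z₀ r, ∀ θ : ℝ, ![z, Circle.exp θ * w] ∈ ellipsoid p := by
    intro z hz θ
    have := hrE hz
    simpa [ellipsoid] using this
  have hd := differentiableAt_integral_exp_mul (isOpen_ellipsoid hp) hf hr hrot b
  have heq : (fun z => taylorCoeff b fun w => f ![z, w]) =ᶠ[𝓝 z₀] fun z =>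
      (∫ θ in 0..2 * Real.pi, conj (Circle.exp θ : ℂ) ^ b * f ![z, Circle.exp θ * w]) *
        (2 * Real.pi * w ^ b)⁻¹ := by
    filter_upwards [ball_mem_nhds z₀ hr] with z hz
    have hz1 : ‖z‖ < 1 := by simpa using norm_zero_lt_one_of_mem_ellipsoid (hrE hz)
    rw [integral_exp_mul_rotation (differentiableOn_slice hp hf hz1)
      ((mem_ellipsoid_iff hp hz1).1 (hrE hz))]
    have hpi : (Real.pi : ℂ) ≠ 0 := Complex.ofReal_ne_zero.2 Real.pi_ne_zero
    field_simp
  exact ((hd.mul_const _).congr_of_eventuallyEq heq).differentiableWithinAt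

/-- The Taylor coefficient of `z ^ a * w ^ b` of a function on the ellipsoid. -/
noncomputable def taylorCoeff₂ (a b : ℕ) (f : (Fin 2 → ℂ) → ℂ) : ℂ :=
  taylorCoeff a fun z => taylorCoeff b fun w => f ![z, w]

theorem eq_zero_of_taylorCoeff₂_eq_zero (hp : 0 < p) (hf : DifferentiableOn ℂ f (ellipsoid p))
    (h : ∀ a b, taylorCoeff₂ a b f = 0) {ζ : Fin 2 → ℂ} (hζ : ζ ∈ ellipsoid p) : f ζ = 0 := by
  have h0 := norm_zero_lt_one_of_mem_ellipsoid hζ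
  have := eq_zero_of_taylorCoeff_eq_zero (differentiableOn_slice hp hf h0)
    (fun b => eq_zero_of_taylorCoeff_eq_zero (differentiableOn_taylorCoeff_slice hp hf b)
      (fun a => h a b) (by simpa using h0)) (slice_mem_ball hp hζ)
  rwa [← update_one_eq, Function.update_eq_self] at this

theorem taylorCoeff₂_monomialFun (a b a' b' : ℕ) :
    taylorCoeff₂ a b (monomialFun a' b') = if a' = a ∧ b' = b then 1 else 0 := by
  have h1 (z : ℂ) : (taylorCoeff b fun w => monomialFun a' b' ![z, w]) =
      if b' = b then z ^ a' else 0 := by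
    simpa [monomialFun] using taylorCoeff_const_mul_pow b' b (z ^ a')
  simp_rw [taylorCoeff₂, h1]
  by_cases hb : b' = b
  · simpa [hb] using taylorCoeff_const_mul_pow a' a 1
  · simpa [hb] using taylorCoeff_const_mul_pow 0 a 0

/-- Integrating against a monomial picks out a Taylor coefficient. -/
theorem integral_conj_monomialFun_mul (hp : 0 < p) (hf : DifferentiableOn ℂ f (ellipsoid p))
    (a b : ℕ) (hint : IntegrableOn (fun ζ => conj (monomialFun a b ζ) * f ζ) (ellipsoid p)) :
    ∫ ζ in ellipsoid p, conj (monomialFun a b ζ) * f ζ =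
      taylorCoeff₂ a b f * ∫ ζ in ellipsoid p, ((‖ζ 0‖ ^ (2 * a) * ‖ζ 1‖ ^ (2 * b) : ℝ) : ℂ) := by
  have hmeas (i : Fin 2) : Measurable (Function.uncurry fun (θ : ℝ) (ζ : Fin 2 → ℂ) =>
      Function.update ζ i (Circle.exp θ * ζ i)) := by
    refine Continuous.measurable ?_
    exact continuous_snd.update i (by fun_prop)
  have hpi : (2 * Real.pi : ℂ) ≠ 0 := by
    simp [Real.pi_ne_zero]
  have hE := (isOpen_ellipsoid hp).measurableSet
  set c : ℂ → ℂ := fun z => taylorCoeff b fun w => f ![z, w] with hc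
  -- Averaging over rotations of `w` keeps only the `b`-th Taylor term of `f` in `w`; the same
  -- averaging in `z` below then keeps only the `a`-th term of its coefficient.
  obtain ⟨hi1, he1⟩ := integral_integral_comp_measurePreserving (hmeas 1)
    (fun θ => measurePreserving_update_ellipsoid hp 1 (Circle.exp θ)) hint
  have hstep1 : ∀ ζ ∈ ellipsoid p, (∫ θ in 0..2 * Real.pi,
      conj (monomialFun a b (Function.update ζ 1 (Circle.exp θ * ζ 1))) *
        f (Function.update ζ 1 (Circle.exp θ * ζ 1))) =
      2 * Real.pi * (conj (ζ 0) ^ a * (‖ζ 1‖ ^ (2 * b) : ℝ) * c (ζ 0)) := by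
    intro ζ hζ
    have h := integral_exp_mul_rotation (differentiableOn_slice hp hf
      (norm_zero_lt_one_of_mem_ellipsoid hζ)) (slice_mem_ball hp hζ) b
    have h' := congrArg (fun t => conj (ζ 0) ^ a * conj (ζ 1) ^ b * t) h
    simp only [← intervalIntegral.integral_const_mul] at h'
    convert h' using 1
    · refine intervalIntegral.integral_congr fun θ _ => ?_
      simp only [update_one_eq, monomialFun, Matrix.cons_val_zero, Matrix.cons_val_one, map_mul,
        map_pow, mul_pow]
      ring
    · rw [pow_mul, ← Complex.normSq_eq_norm_sq, Complex.ofReal_pow, ← Complex.mul_conj]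
      ring
  rw [setIntegral_congr_fun hE hstep1, integral_const_mul, mul_right_inj' hpi] at he1
  have hi1' : IntegrableOn (fun ζ : Fin 2 → ℂ =>
      conj (ζ 0) ^ a * (‖ζ 1‖ ^ (2 * b) : ℝ) * c (ζ 0)) (ellipsoid p) := by
    have h := (integrableOn_congr_fun hstep1 hE).1 hi1
    exact (integrable_const_mul_iff (isUnit_iff_ne_zero.2 hpi) _).1 h
  obtain ⟨-, he2⟩ := integral_integral_comp_measurePreserving (hmeas 0)
    (fun θ => measurePreserving_update_ellipsoid hp 0 (Circle.exp θ)) hi1'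
  have hstep2 : ∀ ζ ∈ ellipsoid p, (∫ θ in 0..2 * Real.pi,
      conj (Function.update ζ 0 (Circle.exp θ * ζ 0) 0) ^ a *
        (‖Function.update ζ 0 (Circle.exp θ * ζ 0) 1‖ ^ (2 * b) : ℝ) *
        c (Function.update ζ 0 (Circle.exp θ * ζ 0) 0)) =
      2 * Real.pi * (taylorCoeff₂ a b f * ((‖ζ 0‖ ^ (2 * a) * ‖ζ 1‖ ^ (2 * b) : ℝ) : ℂ)) := by
    intro ζ hζ
    have h := integral_exp_mul_rotation (differentiableOn_taylorCoeff_slice hp hf b)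
      (w := ζ 0) (by simpa using norm_zero_lt_one_of_mem_ellipsoid hζ) a
    have h' := congrArg (fun t => conj (ζ 0) ^ a * (‖ζ 1‖ ^ (2 * b) : ℝ) * t) h
    simp only [← intervalIntegral.integral_const_mul] at h'
    convert h' using 1
    · refine intervalIntegral.integral_congr fun θ _ => ?_
      simp only [update_zero_eq, Matrix.cons_val_zero, Matrix.cons_val_one, map_mul, mul_pow, hc]
      ring
    · rw [Complex.ofReal_mul, pow_mul ‖ζ 0‖, ← Complex.normSq_eq_norm_sq, Complex.ofReal_pow,
        ← Complex.mul_conj, taylorCoeff₂]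
      ring
  rw [setIntegral_congr_fun hE hstep2, integral_const_mul, mul_right_inj' hpi,
    integral_const_mul] at he2
  rw [← he1, ← he2]

end Ellipsoid

/-! ### Norms of the monomials -/

/-- The integrals `∫₀¹ r ^ (2 a + 1) (1 - r²) ^ c dr` in terms of rising factorials. -/
theorem integral_pow_mul_one_sub_sq_rpow {c : ℝ} (hc : 0 < c) (a : ℕ) :
    ∫ r in (0 : ℝ)..1, r ^ (2 * a + 1) * (1 - r ^ 2) ^ c =
      (2 * (c + 1) * Ring.choose (c + 2 + a - 1) a)⁻¹ := by
  have hderiv (k : ℕ) (r : ℝ) : HasDerivAt (fun r : ℝ => r ^ k * (1 - r ^ 2) ^ (c + 1))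
      (k * r ^ (k - 1) * (1 - r ^ 2) ^ (c + 1) -
        2 * (c + 1) * (r ^ (k + 1) * (1 - r ^ 2) ^ c)) r := by
    have h1 : HasDerivAt (fun r : ℝ => 1 - r ^ 2) (-(2 * r)) r := by
      simpa using (hasDerivAt_pow 2 r).const_sub 1
    have h2 := h1.rpow_const (p := c + 1) (Or.inr (by linarith))
    refine ((hasDerivAt_pow k r).mul h2).congr_deriv ?_
    rw [add_sub_cancel_right]
    ring
  have hcont (e : ℝ) (he : 0 < e) (k : ℕ) :
      Continuous fun r : ℝ => r ^ k * (1 - r ^ 2) ^ e :=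
    (continuous_pow k).mul (Continuous.rpow_const (by fun_prop) fun _ => Or.inr he.le)
  have hint (e : ℝ) (he : 0 < e) (k : ℕ) :
      IntervalIntegrable (fun r : ℝ => r ^ k * (1 - r ^ 2) ^ e) volume 0 1 :=
    (hcont e he k).intervalIntegrable _ _
  -- The primitive vanishes at `r = 1`, and at `r = 0` unless `k = 0`. The case `k = 0` starts the
  -- induction and `k = 2 * a + 2` gives its recursion; the truncated `k - 1` at `k = 0` is
  -- harmless, being multiplied by `k`.
  have hftc (k : ℕ) : ∫ r in (0 : ℝ)..1, (k * r ^ (k - 1) * (1 - r ^ 2) ^ (c + 1) -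
        2 * (c + 1) * (r ^ (k + 1) * (1 - r ^ 2) ^ c)) = if k = 0 then -1 else 0 := by
    rw [intervalIntegral.integral_eq_sub_of_hasDerivAt (fun r _ => hderiv k r)]
    · have : (0 : ℝ) ^ (c + 1) = 0 := Real.zero_rpow (by linarith)
      split_ifs with hk <;> simp [this, hk]
    · simp_rw [mul_assoc]
      exact ((hint (c + 1) (by linarith) (k - 1)).const_mul _).sub
        (((hint c hc (k + 1)).const_mul _).const_mul _)
  induction a with
  | zero =>
    have h := hftc 0
    simp only [Nat.cast_zero, zero_mul, zero_sub, zero_add, pow_one, if_true,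
      intervalIntegral.integral_neg, intervalIntegral.integral_const_mul, neg_inj] at h
    simp only [mul_zero, zero_add, pow_one, Ring.choose_zero_right, mul_one]
    refine eq_inv_of_mul_eq_one_left ?_
    rw [mul_comm]
    exact h
  | succ a ih =>
    have h := hftc (2 * a + 2)
    have hsplit : ∀ r ∈ uIcc (0 : ℝ) 1, ((2 * a + 2 : ℕ) * r ^ (2 * a + 2 - 1) *
        (1 - r ^ 2) ^ (c + 1) - 2 * (c + 1) * (r ^ (2 * a + 2 + 1) * (1 - r ^ 2) ^ c)) =
        (2 * a + 2) * (r ^ (2 * a + 1) * (1 - r ^ 2) ^ c) -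
          2 * (a + c + 2) * (r ^ (2 * (a + 1) + 1) * (1 - r ^ 2) ^ c) := by
      intro r hr
      rw [uIcc_of_le zero_le_one] at hr
      have h0 : 0 ≤ 1 - r ^ 2 := by nlinarith [hr.1, hr.2]
      rw [Real.rpow_add_one' h0 (by linarith), show 2 * a + 2 - 1 = 2 * a + 1 by omega,
        show 2 * (a + 1) + 1 = 2 * a + 1 + 2 by ring, show 2 * a + 2 + 1 = 2 * a + 1 + 2 by ring,
        pow_add r (2 * a + 1) 2]
      push_cast
      ring
    rw [intervalIntegral.integral_congr hsplit, intervalIntegral.integral_sub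
      ((hint c hc _).const_mul _) ((hint c hc _).const_mul _),
      intervalIntegral.integral_const_mul, intervalIntegral.integral_const_mul, ih] at h
    simp only [Nat.add_eq_zero_iff, OfNat.ofNat_ne_zero, and_false, if_false] at h
    -- `Ring.choose (c + 2 + a - 1) a` is the rising factorial `(c + 2)(c + 3)⋯(c + 1 + a)` divided
    -- by `a!`.
    have hrec : (a + 1 : ℝ) * Ring.choose (c + 2 + (a + 1 : ℕ) - 1) (a + 1) =
        Ring.choose (c + 2 + a - 1) a * (c + 2 + a) := by
      have h1 := Ring.factorial_nsmul_multichoose_eq_ascPochhammer (c + 2) (a + 1)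
      have h2 := Ring.factorial_nsmul_multichoose_eq_ascPochhammer (c + 2) a
      rw [Ring.multichoose_eq, Polynomial.ascPochhammer_smeval_eq_eval, nsmul_eq_mul] at h1 h2
      rw [ascPochhammer_succ_eval, ← h2, Nat.factorial_succ] at h1
      have := Nat.factorial_pos a
      have h3 : (a.factorial : ℝ) ≠ 0 := by positivity
      push_cast at h1 ⊢
      apply mul_left_cancel₀ h3
      linear_combination h1
    have hpos : 0 < Ring.choose (c + 2 + a - 1) a := by
      have h2 := Ring.factorial_nsmul_multichoose_eq_ascPochhammer (c + 2) a
      rw [Ring.multichoose_eq, Polynomial.ascPochhammer_smeval_eq_eval, nsmul_eq_mul] at h2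
      have := ascPochhammer_pos a (c + 2) (by linarith)
      rw [← h2] at this
      exact pos_of_mul_pos_right this (by positivity)
    have hpos' : 0 < Ring.choose (c + 2 + (a + 1 : ℕ) - 1) (a + 1) := by
      have : 0 < (a + 1 : ℝ) * Ring.choose (c + 2 + (a + 1 : ℕ) - 1) (a + 1) := by
        rw [hrec]; positivity
      exact pos_of_mul_pos_right this (by positivity)
    set I := ∫ r in (0 : ℝ)..1, r ^ (2 * (a + 1) + 1) * (1 - r ^ 2) ^ c with hI
    refine eq_inv_of_mul_eq_one_left ?_
    have h4 : (2 * a + 2) * (2 * (c + 1) * Ring.choose (c + 2 + a - 1) a)⁻¹ =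
        2 * (a + c + 2) * I := by linarith
    rw [← div_eq_mul_inv, div_eq_iff (by positivity)] at h4
    have h5 : (0 : ℝ) < 2 * (a + 1) := by positivity
    apply mul_left_cancel₀ h5.ne'
    linear_combination (-1 : ℝ) * h4 + 4 * I * (c + 1) * hrec

theorem integral_ball_norm_pow {R : ℝ} (hR : 0 ≤ R) (b : ℕ) :
    ∫ w in ball (0 : ℂ) R, ‖w‖ ^ (2 * b) = Real.pi * R ^ (2 * (b + 1)) / (b + 1) := by
  have h := integral_fun_norm_addHaar (volume : Measure ℂ)
    (fun r => (Iio R).indicator (fun r => r ^ (2 * b)) r)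
  have h1 : ∫ w in ball (0 : ℂ) R, ‖w‖ ^ (2 * b) =
      ∫ w : ℂ, (Iio R).indicator (fun r => r ^ (2 * b)) ‖w‖ := by
    rw [← integral_indicator measurableSet_ball]
    congr 1; ext w
    simp [indicator]
  have h2 : ∫ y in Ioi (0 : ℝ), y ^ (2 - 1) • (Iio R).indicator (fun r => r ^ (2 * b)) y =
      ∫ y in (0 : ℝ)..R, y ^ (2 * b + 1) := by
    rw [intervalIntegral.integral_of_le hR, integral_Ioc_eq_integral_Ioo,
      ← Ioi_inter_Iio, ← setIntegral_indicator measurableSet_Iio]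
    refine setIntegral_congr_fun measurableSet_Ioi fun y _ => ?_
    simp only [indicator]
    split_ifs
    · simp; ring
    · simp
  rw [h1, h, Complex.finrank_real_complex, h2, integral_pow]
  have h3 : volume.real (ball (0 : ℂ) 1) = Real.pi := by
    simp [Measure.real]
  rw [h3]
  simp only [nsmul_eq_mul, smul_eq_mul]
  push_cast
  field_simp
  ring

theorem integral_ball_one_norm_pow_mul {c : ℝ} (hc : 0 < c) (a : ℕ) :
    ∫ z in ball (0 : ℂ) 1, ‖z‖ ^ (2 * a) * (1 - ‖z‖ ^ 2) ^ c =
      Real.pi / ((c + 1) * Ring.choose (c + 2 + a - 1) a) := by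
  have h := integral_fun_norm_addHaar (volume : Measure ℂ)
    (fun r => (Iio 1).indicator (fun r => r ^ (2 * a) * (1 - r ^ 2) ^ c) r)
  have h1 : ∫ z in ball (0 : ℂ) 1, ‖z‖ ^ (2 * a) * (1 - ‖z‖ ^ 2) ^ c =
      ∫ z : ℂ, (Iio 1).indicator (fun r => r ^ (2 * a) * (1 - r ^ 2) ^ c) ‖z‖ := by
    rw [← integral_indicator measurableSet_ball]
    congr 1; ext w
    simp [indicator]
  have h2 : ∫ y in Ioi (0 : ℝ), y ^ (2 - 1) •
      (Iio 1).indicator (fun r => r ^ (2 * a) * (1 - r ^ 2) ^ c) y =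
      ∫ y in (0 : ℝ)..1, y ^ (2 * a + 1) * (1 - y ^ 2) ^ c := by
    rw [intervalIntegral.integral_of_le zero_le_one, integral_Ioc_eq_integral_Ioo,
      ← Ioi_inter_Iio, ← setIntegral_indicator measurableSet_Iio]
    refine setIntegral_congr_fun measurableSet_Ioi fun y _ => ?_
    simp only [indicator]
    split_ifs
    · simp; ring
    · simp
  rw [h1, h, Complex.finrank_real_complex, h2, integral_pow_mul_one_sub_sq_rpow hc]
  have h3 : volume.real (ball (0 : ℂ) 1) = Real.pi := by
    simp [Measure.real]
  rw [h3]
  simp only [nsmul_eq_mul, smul_eq_mul, mul_inv]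
  push_cast
  field_simp

/-- The squared norm of `z ^ a * w ^ b` in `L²` of the ellipsoid. -/
theorem integral_ellipsoid_norm_pow {p : ℝ} (hp : 0 < p) (a b : ℕ) :
    ∫ ζ in ellipsoid p, ‖ζ 0‖ ^ (2 * a) * ‖ζ 1‖ ^ (2 * b) =
      Real.pi ^ 2 / ((b + 1) * ((b + 1) / p + 1) * Ring.choose ((b + 1) / p + 2 + a - 1) a) := by
  set c : ℝ := (b + 1) / p with hc
  have hc0 : 0 < c := by positivity
  have hE := (isOpen_ellipsoid hp).measurableSet
  set g : (Fin 2 → ℂ) → ℝ :=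
    (ellipsoid p).indicator fun ζ => ‖ζ 0‖ ^ (2 * a) * ‖ζ 1‖ ^ (2 * b) with hg
  have hgi : Integrable g volume := by
    rw [hg, integrable_indicator_iff hE]
    refine Measure.integrableOn_of_bounded (M := 1) (volume_ellipsoid_lt_top hp).ne
      (Continuous.aestronglyMeasurable (by fun_prop)) ?_
    filter_upwards [ae_restrict_mem hE] with ζ hζ
    have := norm_monomialFun_le_one hp a b hζ
    have h' : ‖‖ζ 0‖ ^ (2 * a) * ‖ζ 1‖ ^ (2 * b)‖ = ‖monomialFun a b ζ‖ ^ 2 := by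
      rw [Real.norm_of_nonneg (by positivity), monomialFun, norm_mul, norm_pow, norm_pow]
      ring
    rw [h']
    exact pow_le_one₀ (norm_nonneg _) this
  have hmp := (volume_preserving_finTwoArrow ℂ).symm
  have hgi' := (hmp.integrable_comp_emb (MeasurableEquiv.measurableEmbedding _)).2 hgi
  have hz : ∀ z : ℂ, ∫ w, g ![z, w] =
      (ball (0 : ℂ) 1).indicator
        (fun z => Real.pi / (b + 1) * (‖z‖ ^ (2 * a) * (1 - ‖z‖ ^ 2) ^ c)) z := by
    intro z
    by_cases hz1 : ‖z‖ < 1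
    · have h0 : 0 < 1 - ‖z‖ ^ 2 := by nlinarith [norm_nonneg z]
      set R : ℝ := (1 - ‖z‖ ^ 2) ^ (1 / (2 * p)) with hR
      have hR0 : 0 ≤ R := by positivity
      have h1 : (fun w => g ![z, w]) =
          (ball (0 : ℂ) R).indicator fun w => ‖z‖ ^ (2 * a) * ‖w‖ ^ (2 * b) := by
        ext w
        by_cases hw : ![z, w] ∈ ellipsoid p
        · rw [hg, indicator_of_mem hw, indicator_of_mem ((mem_ellipsoid_iff hp hz1).1 hw)]
          simp
        · rw [hg, indicator_of_notMem hw,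
            indicator_of_notMem fun h => hw ((mem_ellipsoid_iff hp hz1).2 h)]
      -- The slice integral in `w` is proportional to this power of the radius, hence the exponent
      -- `c = (b + 1) / p`.
      have h2 : R ^ (2 * (b + 1)) = (1 - ‖z‖ ^ 2) ^ c := by
        rw [hR, ← Real.rpow_natCast, ← Real.rpow_mul h0.le]
        congr 1
        push_cast
        rw [hc]
        field_simp
      rw [h1, integral_indicator measurableSet_ball, integral_const_mul,
        integral_ball_norm_pow hR0, h2, indicator_of_mem (by simpa using hz1)]
      ring
    · rw [indicator_of_notMem (by simpa using hz1)]
      have h1 : (fun w => g ![z, w]) = 0 := by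
        ext w
        rw [hg, indicator_of_notMem]
        · rfl
        · intro h
          exact hz1 (by simpa using norm_zero_lt_one_of_mem_ellipsoid h)
      rw [h1]
      simp
  calc ∫ ζ in ellipsoid p, ‖ζ 0‖ ^ (2 * a) * ‖ζ 1‖ ^ (2 * b) = ∫ ζ, g ζ := by
        rw [integral_indicator hE]
    _ = ∫ q : ℂ × ℂ, g ![q.1, q.2] :=
        (hmp.integral_comp (MeasurableEquiv.measurableEmbedding _) g).symm
    _ = ∫ z : ℂ, ∫ w : ℂ, g ![z, w] := integral_prod (fun q : ℂ × ℂ => g ![q.1, q.2]) hgi'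
    _ = _ := by
        simp_rw [hz]
        rw [integral_indicator measurableSet_ball, integral_const_mul,
          integral_ball_one_norm_pow_mul hc0]
        field_simp

theorem inner_bergmanSpace {n : ℕ} {D : Set (Fin n → ℂ)} (f g : bergmanSpace D) :
    @inner ℂ _ InnerProductSpace.toInner f g = ∫ ζ in D, conj (holoRep f ζ) * holoRep g ζ := by
  change @inner ℂ _ InnerProductSpace.toInner
    (f : Lp ℂ 2 ((volume : Measure (Fin n → ℂ)).restrict D)) g = _
  rw [L2.inner_def]
  refine integral_congr_ae ?_
  filter_upwards [coeFn_ae_eq_holoRep f, coeFn_ae_eq_holoRep g] with ζ h1 h2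
  rw [h1, h2, RCLike.inner_apply, mul_comm]

theorem integrable_conj_mul_bergmanSpace {n : ℕ} {D : Set (Fin n → ℂ)} (f g : bergmanSpace D) :
    IntegrableOn (fun ζ => conj (holoRep f ζ) * holoRep g ζ) D := by
  refine (L2.integrable_inner (𝕜 := ℂ)
    (f : Lp ℂ 2 ((volume : Measure (Fin n → ℂ)).restrict D)) g).congr ?_
  filter_upwards [coeFn_ae_eq_holoRep f, coeFn_ae_eq_holoRep g] with ζ h1 h2
  rw [h1, h2, RCLike.inner_apply, mul_comm]

theorem inner_smul_left_bergmanSpace {n : ℕ} {D : Set (Fin n → ℂ)} (c : ℂ) (f g : bergmanSpace D) :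
    @inner ℂ _ InnerProductSpace.toInner (c • f) g =
      conj c * @inner ℂ _ InnerProductSpace.toInner f g :=
  inner_smul_left (𝕜 := ℂ) (E := bergmanSpace D) f g c

theorem inner_smul_right_bergmanSpace {n : ℕ} {D : Set (Fin n → ℂ)} (c : ℂ)
    (f g : bergmanSpace D) :
    @inner ℂ _ InnerProductSpace.toInner f (c • g) =
      c * @inner ℂ _ InnerProductSpace.toInner f g :=
  inner_smul_right (𝕜 := ℂ) (E := bergmanSpace D) f g c

/-! ### The monomial basis and the closed form of the kernel -/

section Ellipsoid

variable {p : ℝ}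

theorem memLp_monomialFun (hp : 0 < p) (a b : ℕ) :
    MemLp (monomialFun a b) 2 (volume.restrict (ellipsoid p)) := by
  have : IsFiniteMeasure (volume.restrict (ellipsoid p)) :=
    ⟨by simpa using volume_ellipsoid_lt_top hp⟩
  refine MemLp.of_bound (continuous_monomialFun a b).aestronglyMeasurable 1 ?_
  filter_upwards [ae_restrict_mem (isOpen_ellipsoid hp).measurableSet] with ζ hζ
  exact norm_monomialFun_le_one hp a b hζ

/-- The monomial `z ^ a * w ^ b` as an element of the Bergman space of the ellipsoid. -/
noncomputable def monomialClass (hp : 0 < p) (a b : ℕ) : bergmanSpace (ellipsoid p) :=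
  ⟨(memLp_monomialFun hp a b).toLp, monomialFun a b,
    (differentiable_monomialFun a b).differentiableOn, MemLp.coeFn_toLp _⟩

theorem holoRep_monomialClass (hp : 0 < p) (a b : ℕ) :
    EqOn (holoRep (monomialClass hp a b)) (monomialFun a b) (ellipsoid p) :=
  holoRep_eqOn (isOpen_ellipsoid hp) (continuous_monomialFun a b).continuousOn
    (MemLp.coeFn_toLp (memLp_monomialFun hp a b))

/-- The squared norm of `z ^ a * w ^ b` in the Bergman space of the ellipsoid. -/
noncomputable def monomialNormSq (p : ℝ) (a b : ℕ) : ℝ :=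
  ∫ ζ in ellipsoid p, ‖ζ 0‖ ^ (2 * a) * ‖ζ 1‖ ^ (2 * b)

theorem monomialNormSq_pos (hp : 0 < p) (a b : ℕ) : 0 < monomialNormSq p a b := by
  rw [monomialNormSq, integral_ellipsoid_norm_pow hp]
  have h2 := Ring.factorial_nsmul_multichoose_eq_ascPochhammer (((b : ℝ) + 1) / p + 2) a
  rw [Ring.multichoose_eq, Polynomial.ascPochhammer_smeval_eq_eval, nsmul_eq_mul] at h2
  have := ascPochhammer_pos a (((b : ℝ) + 1) / p + 2) (by positivity)
  rw [← h2] at this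
  have := pos_of_mul_pos_right this (by positivity)
  positivity

theorem inner_monomialClass (hp : 0 < p) (a b : ℕ) (f : bergmanSpace (ellipsoid p)) :
    @inner ℂ _ InnerProductSpace.toInner (monomialClass hp a b) f =
      taylorCoeff₂ a b (holoRep f) * (monomialNormSq p a b : ℂ) := by
  have hE := (isOpen_ellipsoid hp).measurableSet
  have heq : EqOn (fun ζ => conj (holoRep (monomialClass hp a b) ζ) * holoRep f ζ)
      (fun ζ => conj (monomialFun a b ζ) * holoRep f ζ) (ellipsoid p) := fun ζ hζ => by
    simp only [holoRep_monomialClass hp a b hζ]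
  rw [inner_bergmanSpace, setIntegral_congr_fun hE heq, integral_conj_monomialFun_mul hp
    (differentiableOn_holoRep f) a b
    ((integrableOn_congr_fun heq hE).1 (integrable_conj_mul_bergmanSpace _ _)), monomialNormSq,
    integral_complex_ofReal]

/-- Iterated derivatives at the origin see only germs. This is needed because `holoRep` is
determined only on the domain. -/
theorem taylorCoeff₂_congr (hp : 0 < p) {f g : (Fin 2 → ℂ) → ℂ} (h : EqOn f g (ellipsoid p))
    (a b : ℕ) : taylorCoeff₂ a b f = taylorCoeff₂ a b g := by
  have h1 : ∀ z ∈ ball (0 : ℂ) 1,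
      (taylorCoeff b fun w => f ![z, w]) = taylorCoeff b fun w => g ![z, w] := by
    intro z hz
    rw [mem_ball_zero_iff] at hz
    have h0 : 0 < 1 - ‖z‖ ^ 2 := by nlinarith [norm_nonneg z]
    have hR : 0 < (1 - ‖z‖ ^ 2) ^ (1 / (2 * p)) := by positivity
    rw [taylorCoeff, taylorCoeff, Filter.EventuallyEq.iteratedDeriv_eq b]
    filter_upwards [ball_mem_nhds 0 hR] with w hw
    exact h ((mem_ellipsoid_iff hp hz).2 hw)
  rw [taylorCoeff₂, taylorCoeff₂, taylorCoeff, taylorCoeff,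
    Filter.EventuallyEq.iteratedDeriv_eq a]
  filter_upwards [ball_mem_nhds 0 one_pos] with z hz
  exact h1 z hz

/-- The normalized monomials, indexed by the exponents of `w` and `z`. -/
noncomputable def normalizedMonomial (hp : 0 < p) (q : ℕ × ℕ) : bergmanSpace (ellipsoid p) :=
  (((√(monomialNormSq p q.2 q.1))⁻¹ : ℝ) : ℂ) • monomialClass hp q.2 q.1

theorem inner_monomialClass_monomialClass (hp : 0 < p) (a b a' b' : ℕ) :
    @inner ℂ _ InnerProductSpace.toInner (monomialClass hp a b) (monomialClass hp a' b') =
      if a' = a ∧ b' = b then (monomialNormSq p a b : ℂ) else 0 := by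
  rw [inner_monomialClass, taylorCoeff₂_congr hp (holoRep_monomialClass hp a' b'),
    taylorCoeff₂_monomialFun]
  split_ifs <;> simp

theorem orthonormal_normalizedMonomial (hp : 0 < p) : Orthonormal ℂ (normalizedMonomial hp) := by
  classical
  rw [orthonormal_iff_ite]
  rintro ⟨b, a⟩ ⟨b', a'⟩
  simp only [normalizedMonomial, inner_smul_left_bergmanSpace, inner_smul_right_bergmanSpace,
    inner_monomialClass_monomialClass, Prod.mk.injEq]
  by_cases h : a' = a ∧ b' = b
  · obtain ⟨rfl, rfl⟩ := h
    have h0 := monomialNormSq_pos hp a' b'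
    simp only [and_self, if_true, Complex.conj_ofReal]
    rw [← Complex.ofReal_mul, ← Complex.ofReal_mul, ← mul_assoc, ← mul_inv,
      Real.mul_self_sqrt h0.le, inv_mul_cancel₀ h0.ne', Complex.ofReal_one]
  · rw [if_neg h, if_neg fun h' => h ⟨h'.2.symm, h'.1.symm⟩]
    simp

/-- A function orthogonal to every monomial has all Taylor coefficients zero, so it vanishes on the
ellipsoid. -/
theorem orthogonal_span_normalizedMonomial (hp : 0 < p) :
    (Submodule.span ℂ (Set.range (normalizedMonomial hp)))ᗮ = ⊥ := by
  rw [eq_bot_iff]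
  intro f hf
  rw [Submodule.mem_orthogonal] at hf
  have hcoeff (a b : ℕ) : taylorCoeff₂ a b (holoRep f) = 0 := by
    have h0 := monomialNormSq_pos hp a b
    have h1 := hf _ (Submodule.subset_span ⟨(b, a), rfl⟩)
    simp only [normalizedMonomial, inner_smul_left_bergmanSpace, inner_monomialClass] at h1
    simpa [h0.ne', (Real.sqrt_pos.2 h0).ne'] using h1
  have hzero : ∀ ζ ∈ ellipsoid p, holoRep f ζ = 0 := fun ζ hζ =>
    eq_zero_of_taylorCoeff₂_eq_zero hp (differentiableOn_holoRep f) hcoeff hζ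
  rw [Submodule.mem_bot, ← inner_self_eq_zero (𝕜 := ℂ), inner_bergmanSpace]
  refine (setIntegral_congr_fun (g := fun _ => (0 : ℂ)) (isOpen_ellipsoid hp).measurableSet
    fun ζ hζ => ?_).trans (by simp)
  simp [hzero ζ hζ]

/-- The monomial expansion of the Bergman kernel of the ellipsoid. -/
theorem hasSum_bergmanKernel_ellipsoid (hp : 0 < p) {ζ : Fin 2 → ℂ} (hζ : ζ ∈ ellipsoid p) :
    HasSum (fun q : ℕ × ℕ => ‖ζ 0‖ ^ (2 * q.2) * ‖ζ 1‖ ^ (2 * q.1) / monomialNormSq p q.2 q.1)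
      (bergmanKernel (ellipsoid p) ζ) := by
  have := completeSpace_bergmanSpace (isOpen_ellipsoid hp)
  have h := bergmanKernel_eq_tsum (isOpen_ellipsoid hp)
    (HilbertBasis.mkOfOrthogonalEqBot (orthonormal_normalizedMonomial hp)
      (orthogonal_span_normalizedMonomial hp)) hζ
  convert h using 2 with q
  have h0 := monomialNormSq_pos hp q.2 q.1
  rw [HilbertBasis.coe_mkOfOrthogonalEqBot, normalizedMonomial,
    holoRep_smul (isOpen_ellipsoid hp) _ _ hζ, Pi.smul_apply, holoRep_monomialClass hp _ _ hζ,
    norm_smul, mul_pow, Complex.norm_real, Real.norm_of_nonneg (by positivity), inv_pow,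
    Real.sq_sqrt h0.le, monomialFun, norm_mul, norm_pow, norm_pow]
  ring

theorem hasSum_choose_mul_pow (c : ℝ) {s : ℝ} (h0 : 0 ≤ s) (h1 : s < 1) :
    HasSum (fun a : ℕ => Ring.choose (c + a - 1) a * s ^ a) ((1 - s) ^ c)⁻¹ := by
  have h := (Real.one_div_one_sub_rpow_hasFPowerSeriesOnBall_zero c).hasSum (y := s) (by
    rw [← ENNReal.ofReal_one, Metric.eball_ofReal, mem_ball_zero_iff, Real.norm_of_nonneg h0]
    exact h1)
  simpa [mul_comm] using h

/-- The ratio `|w|² / (1 - |z|²) ^ (1 / p)`. -/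
noncomputable def ellipsoidRatio (p : ℝ) (ζ : Fin 2 → ℂ) : ℝ :=
  ‖ζ 1‖ ^ 2 * (1 - ‖ζ 0‖ ^ 2) ^ (-(1 / p))

theorem ellipsoidRatio_nonneg {ζ : Fin 2 → ℂ} (hζ : ζ ∈ ellipsoid p) :
    0 ≤ ellipsoidRatio p ζ := by
  have h0 : 0 < 1 - ‖ζ 0‖ ^ 2 := by
    nlinarith [norm_nonneg (ζ 0), norm_zero_lt_one_of_mem_ellipsoid hζ]
  unfold ellipsoidRatio
  positivity

theorem ellipsoidRatio_lt_one (hp : 0 < p) {ζ : Fin 2 → ℂ} (hζ : ζ ∈ ellipsoid p) :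
    ellipsoidRatio p ζ < 1 := by
  have h0 : 0 < 1 - ‖ζ 0‖ ^ 2 := by
    nlinarith [norm_nonneg (ζ 0), norm_zero_lt_one_of_mem_ellipsoid hζ]
  have h := slice_mem_ball hp hζ
  rw [mem_ball_zero_iff] at h
  have h2 : ‖ζ 1‖ ^ 2 < (1 - ‖ζ 0‖ ^ 2) ^ (1 / p) := by
    have h3 : ((1 - ‖ζ 0‖ ^ 2) ^ (1 / (2 * p))) ^ 2 = (1 - ‖ζ 0‖ ^ 2) ^ (1 / p) := by
      rw [← Real.rpow_natCast, ← Real.rpow_mul h0.le]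
      congr 1
      field_simp
      norm_num
    rw [← h3]
    exact pow_lt_pow_left₀ h (norm_nonneg _) two_ne_zero
  rw [ellipsoidRatio, Real.rpow_neg h0.le, ← div_eq_mul_inv, div_lt_one (by positivity)]
  exact h2

/-- The closed form of the Bergman kernel of the ellipsoid on the diagonal. -/
theorem bergmanKernel_ellipsoid (hp : 0 < p) {ζ : Fin 2 → ℂ} (hζ : ζ ∈ ellipsoid p) :
    bergmanKernel (ellipsoid p) ζ = 1 / (Real.pi ^ 2 * p) * (1 - ‖ζ 0‖ ^ 2) ^ (-(2 + 1 / p)) *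
      (((1 + p) + (1 - p) * ellipsoidRatio p ζ) / (1 - ellipsoidRatio p ζ) ^ 3) := by
  set s := ‖ζ 0‖ ^ 2 with hs
  set u := ellipsoidRatio p ζ with hu
  have hs0 : 0 ≤ s := by positivity
  have hs1 : s < 1 := by
    nlinarith [norm_nonneg (ζ 0), norm_zero_lt_one_of_mem_ellipsoid hζ]
  have hq : 0 < 1 - s := by linarith
  have hu0 : 0 ≤ u := ellipsoidRatio_nonneg hζ
  have hu1 : u < 1 := ellipsoidRatio_lt_one hp hζ
  -- For fixed `b` the sum over `a` is a binomial series. The remaining factor `(b + 1)((b + 1) / p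
  -- + 1)` equals `1/p` times `2 * (b + 2).choose 2 + (p - 1) * (b + 1).choose 1`, whose series in
  -- `u` are `(1 - u)⁻³` and `(1 - u)⁻²`.
  have hfib (b : ℕ) : HasSum (fun a : ℕ =>
      ‖ζ 0‖ ^ (2 * a) * ‖ζ 1‖ ^ (2 * b) / monomialNormSq p a b)
      (1 / (Real.pi ^ 2 * p) * (1 - s) ^ (-(2 + 1 / p)) *
        (2 * ((b + 2).choose 2 * u ^ b) + (p - 1) * ((b + 1).choose 1 * u ^ b))) := by
    have h := (hasSum_choose_mul_pow (((b : ℝ) + 1) / p + 2) hs0 hs1).mul_left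
      (‖ζ 1‖ ^ (2 * b) * ((b + 1) * ((b + 1) / p + 1)) / Real.pi ^ 2)
    have hpow : ((1 - s) ^ (((b : ℝ) + 1) / p + 2))⁻¹ * ‖ζ 1‖ ^ (2 * b) =
        (1 - s) ^ (-(2 + 1 / p)) * u ^ b := by
      rw [hu, ellipsoidRatio, mul_pow, ← Real.rpow_natCast ((1 - ‖ζ 0‖ ^ 2) ^ (-(1 / p))) b,
        ← Real.rpow_mul hq.le, ← Real.rpow_neg hq.le, pow_mul, mul_comm, mul_left_comm,
        ← Real.rpow_add hq]
      congr 2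
      field_simp
      ring
    have hch : (((b + 2).choose 2 : ℕ) : ℝ) = (b + 1) * (b + 2) / 2 := by
      rw [Nat.cast_choose_two]
      push_cast
      ring
    have hterm (a : ℕ) : ‖ζ 0‖ ^ (2 * a) * ‖ζ 1‖ ^ (2 * b) / monomialNormSq p a b =
        ‖ζ 1‖ ^ (2 * b) * ((b + 1) * ((b + 1) / p + 1)) / Real.pi ^ 2 *
          (Ring.choose (((b : ℝ) + 1) / p + 2 + a - 1) a * s ^ a) := by
      rw [monomialNormSq, integral_ellipsoid_norm_pow hp, pow_mul ‖ζ 0‖, ← hs]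
      field_simp
    have hval : ‖ζ 1‖ ^ (2 * b) * ((b + 1) * ((b + 1) / p + 1)) / Real.pi ^ 2 *
        ((1 - s) ^ (((b : ℝ) + 1) / p + 2))⁻¹ = 1 / (Real.pi ^ 2 * p) *
        (1 - s) ^ (-(2 + 1 / p)) *
        (2 * ((b + 2).choose 2 * u ^ b) + (p - 1) * ((b + 1).choose 1 * u ^ b)) := by
      rw [mul_div_assoc, mul_right_comm, mul_comm (‖ζ 1‖ ^ (2 * b)), hpow, hch]
      simp only [Nat.choose_one_right]
      push_cast
      field_simp
      ring
    rw [hval] at h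
    simp_rw [hterm]
    exact h
  have h := (hasSum_bergmanKernel_ellipsoid hp hζ).prod_fiberwise hfib
  have hun : ‖u‖ < 1 := by rwa [Real.norm_of_nonneg hu0]
  have h2 := (((hasSum_choose_mul_geometric_of_norm_lt_one 2 hun).mul_left 2).add
    ((hasSum_choose_mul_geometric_of_norm_lt_one 1 hun).mul_left (p - 1))).mul_left
    (1 / (Real.pi ^ 2 * p) * (1 - s) ^ (-(2 + 1 / p)))
  rw [h.unique h2]
  have : 1 - u ≠ 0 := by linarith
  congr 1
  field_simp
  ring

end Ellipsoid

/-! ### Wirtinger calculus -/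

section Wirtinger

variable {n : ℕ}

/-- The real-linear map `v ↦ ∑ᵢ (aᵢ vᵢ + bᵢ v̄ᵢ)`. -/
noncomputable def wirtingerCLM (a b : Fin n → ℂ) : (Fin n → ℂ) →L[ℝ] ℂ :=
  ∑ i, (a i • ContinuousLinearMap.proj (R := ℝ) (φ := fun _ : Fin n => ℂ) i +
    b i • (Complex.conjCLE : ℂ →L[ℝ] ℂ).comp
      (ContinuousLinearMap.proj (R := ℝ) (φ := fun _ : Fin n => ℂ) i))

theorem wirtingerCLM_apply (a b v : Fin n → ℂ) :
    wirtingerCLM a b v = ∑ i, (a i * v i + b i * conj (v i)) := by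
  simp [wirtingerCLM]

/-- `f` is real differentiable at `ζ` with Wirtinger derivatives `∂f/∂zᵢ = aᵢ`,
`∂f/∂z̄ᵢ = bᵢ`. -/
def HasWirtingerAt (f : (Fin n → ℂ) → ℂ) (a b : Fin n → ℂ) (ζ : Fin n → ℂ) : Prop :=
  HasFDerivAt f (wirtingerCLM a b) ζ

variable {f g : (Fin n → ℂ) → ℂ} {a b a' b' ζ : Fin n → ℂ}

theorem wirtingerCLM_single (a b : Fin n → ℂ) (i : Fin n) (c : ℂ) :
    wirtingerCLM a b (Pi.single i c) = a i * c + b i * conj c := by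
  rw [wirtingerCLM_apply, Finset.sum_eq_single i]
  · simp
  · intro j _ hj
    simp [hj]
  · simp

theorem HasWirtingerAt.wirtinger_eq (h : HasWirtingerAt f a b ζ) (i : Fin n) :
    wirtinger i f ζ = a i := by
  rw [wirtinger, HasFDerivAt.fderiv h, wirtingerCLM_single, wirtingerCLM_single]
  simp only [map_one, Complex.conj_I]
  linear_combination (-(1 / 2) * a i + (1 / 2) * b i) * Complex.I_sq

theorem HasWirtingerAt.wirtingerBar_eq (h : HasWirtingerAt f a b ζ) (i : Fin n) :
    wirtingerBar i f ζ = b i := by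
  rw [wirtingerBar, HasFDerivAt.fderiv h, wirtingerCLM_single, wirtingerCLM_single]
  simp only [map_one, Complex.conj_I]
  linear_combination ((1 / 2) * a i - (1 / 2) * b i) * Complex.I_sq

theorem HasWirtingerAt.mul (hf : HasWirtingerAt f a b ζ) (hg : HasWirtingerAt g a' b' ζ) :
    HasWirtingerAt (fun η => f η * g η) (fun i => f ζ * a' i + g ζ * a i)
      (fun i => f ζ * b' i + g ζ * b i) ζ := by
  refine (HasFDerivAt.mul hf hg).congr_fderiv ?_
  ext v
  simp only [wirtingerCLM_apply, add_apply, smul_apply,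
    smul_eq_mul, Finset.mul_sum, ← Finset.sum_add_distrib]
  exact Finset.sum_congr rfl fun i _ => by ring

theorem hasWirtingerAt_apply (i : Fin n) (ζ : Fin n → ℂ) :
    HasWirtingerAt (fun η => η i) (Pi.single i 1) 0 ζ := by
  refine (hasFDerivAt_apply (𝕜 := ℝ) i ζ).congr_fderiv ?_
  ext v
  simp [wirtingerCLM_apply, Pi.single_apply]

theorem hasWirtingerAt_conj_apply (i : Fin n) (ζ : Fin n → ℂ) :
    HasWirtingerAt (fun η => conj (η i)) 0 (Pi.single i 1) ζ := by
  have h := (Complex.conjCLE : ℂ →L[ℝ] ℂ).hasFDerivAt.comp ζ (hasFDerivAt_apply (𝕜 := ℝ) i ζ)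
  refine HasFDerivAt.congr_fderiv h ?_
  ext v
  simp [wirtingerCLM_apply, Pi.single_apply]

theorem HasWirtingerAt.congr_coeff (h : HasWirtingerAt f a b ζ) (ha : a = a') (hb : b = b') :
    HasWirtingerAt f a' b' ζ := ha ▸ hb ▸ h

theorem HasWirtingerAt.congr_of_eventuallyEq (h : HasWirtingerAt f a b ζ) (hfg : g =ᶠ[𝓝 ζ] f) :
    HasWirtingerAt g a b ζ :=
  HasFDerivAt.congr_of_eventuallyEq h hfg

theorem hasWirtingerAt_norm_sq (i : Fin n) (ζ : Fin n → ℂ) :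
    HasWirtingerAt (fun η => ((‖η i‖ ^ 2 : ℝ) : ℂ)) (Pi.single i (conj (ζ i)))
      (Pi.single i (ζ i)) ζ := by
  have h := (hasWirtingerAt_apply i ζ).mul (hasWirtingerAt_conj_apply i ζ)
  simp only [Complex.mul_conj, Complex.normSq_eq_norm_sq] at h
  refine h.congr_coeff ?_ ?_ <;> ext j <;> by_cases hj : j = i <;> simp [hj]

/-- The chain rule for a real function of one real function. -/
theorem HasWirtingerAt.real_comp {r : (Fin n → ℂ) → ℝ}
    (h : HasWirtingerAt (fun η => (r η : ℂ)) a b ζ) {φ : ℝ → ℝ} {d : ℝ}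
    (hφ : HasDerivAt φ d (r ζ)) :
    HasWirtingerAt (fun η => ((φ (r η) : ℝ) : ℂ)) (fun i => d * a i) (fun i => d * b i) ζ := by
  have hr : HasFDerivAt r (Complex.reCLM.comp (wirtingerCLM a b)) ζ := by
    simpa [Function.comp_def] using Complex.reCLM.hasFDerivAt.comp ζ h
  -- Uniqueness of the derivative shows that the differential of a real-valued function is
  -- real-valued, so passing to its real part loses nothing.
  have hu : Complex.ofRealCLM.comp (Complex.reCLM.comp (wirtingerCLM a b)) = wirtingerCLM a b :=
    (Complex.ofRealCLM.hasFDerivAt.comp ζ hr).unique h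
  have h1 := Complex.ofRealCLM.hasFDerivAt.comp ζ (hφ.comp_hasFDerivAt ζ hr)
  refine HasFDerivAt.congr_fderiv h1 ?_
  ext v
  have hv := congrArg (fun M : (Fin n → ℂ) →L[ℝ] ℂ => M v) hu
  simp only [ContinuousLinearMap.comp_apply, smul_apply,
    Complex.ofRealCLM_apply, smul_eq_mul, Complex.ofReal_mul] at hv ⊢
  rw [hv, wirtingerCLM_apply, wirtingerCLM_apply, Finset.mul_sum]
  exact Finset.sum_congr rfl fun i _ => by ring

theorem HasWirtingerAt.real_mul {r t : (Fin n → ℂ) → ℝ}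
    (hr : HasWirtingerAt (fun η => (r η : ℂ)) a b ζ)
    (ht : HasWirtingerAt (fun η => (t η : ℂ)) a' b' ζ) :
    HasWirtingerAt (fun η => ((r η * t η : ℝ) : ℂ)) (fun i => r ζ * a' i + t ζ * a i)
      (fun i => r ζ * b' i + t ζ * b i) ζ := by
  simpa using hr.mul ht

theorem HasWirtingerAt.real_add {r t : (Fin n → ℂ) → ℝ}
    (hr : HasWirtingerAt (fun η => (r η : ℂ)) a b ζ)
    (ht : HasWirtingerAt (fun η => (t η : ℂ)) a' b' ζ) :
    HasWirtingerAt (fun η => ((r η + t η : ℝ) : ℂ)) (a + a') (b + b') ζ := by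
  have h : HasWirtingerAt (fun η => (r η : ℂ) + (t η : ℂ)) (a + a') (b + b') ζ := by
    refine (HasFDerivAt.add hr ht).congr_fderiv ?_
    ext v
    simp only [wirtingerCLM_apply, add_apply, ← Finset.sum_add_distrib,
      Pi.add_apply]
    exact Finset.sum_congr rfl fun i _ => by ring
  simpa using h

end Wirtinger

/-! ### Complex Hessian of potentials in `1 - |z|²` and `u` -/

section Potential

variable {p : ℝ}

theorem one_sub_norm_sq_pos {ζ : Fin 2 → ℂ} (hζ : ζ ∈ ellipsoid p) : 0 < 1 - ‖ζ 0‖ ^ 2 := by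
  nlinarith [norm_nonneg (ζ 0), norm_zero_lt_one_of_mem_ellipsoid hζ]

theorem hasWirtingerAt_comp_one_sub_norm_sq {φ : ℝ → ℝ} {d : ℝ} {ζ : Fin 2 → ℂ}
    (hφ : HasDerivAt φ d (1 - ‖ζ 0‖ ^ 2)) :
    HasWirtingerAt (fun η => ((φ (1 - ‖η 0‖ ^ 2) : ℝ) : ℂ)) ![-d * conj (ζ 0), 0]
      ![-d * ζ 0, 0] ζ := by
  have h : HasDerivAt (fun t => φ (1 - t)) (-d) (‖ζ 0‖ ^ 2) := by
    have := (hasDerivAt_id' (‖ζ 0‖ ^ 2)).const_sub 1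
    simpa [Function.comp_def] using HasDerivAt.comp (‖ζ 0‖ ^ 2) hφ this
  refine ((hasWirtingerAt_norm_sq 0 ζ).real_comp h).congr_coeff ?_ ?_ <;> ext j <;>
    fin_cases j <;> simp

/-- `(1 - |z|²) ^ (-1/p)`. -/
noncomputable def ellipsoidWeight (p : ℝ) (ζ : Fin 2 → ℂ) : ℝ := (1 - ‖ζ 0‖ ^ 2) ^ (-(1 / p))

theorem ellipsoidWeight_pos {ζ : Fin 2 → ℂ} (hζ : ζ ∈ ellipsoid p) : 0 < ellipsoidWeight p ζ :=
  Real.rpow_pos_of_pos (one_sub_norm_sq_pos hζ) _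

theorem hasWirtingerAt_ellipsoidWeight {ζ : Fin 2 → ℂ} (hζ : ζ ∈ ellipsoid p) :
    HasWirtingerAt (fun η => (ellipsoidWeight p η : ℂ))
      ![1 / p * ellipsoidWeight p ζ / (1 - ‖ζ 0‖ ^ 2 : ℝ) * conj (ζ 0), 0]
      ![1 / p * ellipsoidWeight p ζ / (1 - ‖ζ 0‖ ^ 2 : ℝ) * ζ 0, 0] ζ := by
  have hq := one_sub_norm_sq_pos hζ
  have h := hasWirtingerAt_comp_one_sub_norm_sq (ζ := ζ) (Real.hasDerivAt_rpow_const
    (p := -(1 / p)) (Or.inl hq.ne'))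
  have hd : -(-(1 / p) * (1 - ‖ζ 0‖ ^ 2) ^ (-(1 / p) - 1)) =
      1 / p * ellipsoidWeight p ζ / (1 - ‖ζ 0‖ ^ 2) := by
    rw [Real.rpow_sub_one hq.ne', ellipsoidWeight]
    ring
  rw [← Complex.ofReal_neg, hd] at h
  exact_mod_cast h

theorem hasWirtingerAt_ellipsoidRatio {ζ : Fin 2 → ℂ} (hζ : ζ ∈ ellipsoid p) :
    HasWirtingerAt (fun η => (ellipsoidRatio p η : ℂ))
      ![1 / p * ellipsoidRatio p ζ / (1 - ‖ζ 0‖ ^ 2 : ℝ) * conj (ζ 0),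
        ellipsoidWeight p ζ * conj (ζ 1)]
      ![1 / p * ellipsoidRatio p ζ / (1 - ‖ζ 0‖ ^ 2 : ℝ) * ζ 0, ellipsoidWeight p ζ * ζ 1] ζ := by
  refine ((hasWirtingerAt_norm_sq 1 ζ).real_mul (hasWirtingerAt_ellipsoidWeight hζ)).congr_coeff
    ?_ ?_ <;> ext j <;> fin_cases j <;> simp [ellipsoidRatio, ellipsoidWeight] <;> ring

theorem ellipsoidRatio_mem_Ico (hp : 0 < p) {ζ : Fin 2 → ℂ} (hζ : ζ ∈ ellipsoid p) :
    ellipsoidRatio p ζ ∈ Ico (0 : ℝ) 1 :=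
  ⟨ellipsoidRatio_nonneg hζ, ellipsoidRatio_lt_one hp hζ⟩

/-- The complex Hessian of a potential `k - c log (1 - |z|²) + L(u)` on the ellipsoid, where
`u = |w|² (1 - |z|²) ^ (-1/p)`; here `P = u L'(u)` and `Q = P'(u)`. -/
noncomputable def ellipsoidHessian (p c : ℝ) (P Q : ℝ → ℝ) (ζ : Fin 2 → ℂ) :
    Matrix (Fin 2) (Fin 2) ℂ :=
  let q : ℝ := 1 - ‖ζ 0‖ ^ 2
  let u : ℝ := ellipsoidRatio p ζ
  let m : ℝ := ellipsoidWeight p ζ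
  !![(((c + 1 / p * P u) / q ^ 2 + ‖ζ 0‖ ^ 2 * (1 / p) ^ 2 * u * Q u / q ^ 2 : ℝ) : ℂ),
      ((1 / p * m * Q u / q : ℝ) : ℂ) * conj (ζ 0) * ζ 1;
    ((1 / p * m * Q u / q : ℝ) : ℂ) * ζ 0 * conj (ζ 1), ((m * Q u : ℝ) : ℂ)]

/-- Stated for a general profile `L` because it is used twice: for `log K`, giving the metric, and
for `log det g`, giving the Ricci tensor. -/
theorem wirtinger_wirtingerBar_potential (hp : 0 < p) {c k : ℝ} {L L₁ L₂ : ℝ → ℝ}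
    (hL : ∀ u ∈ Ico (0 : ℝ) 1, HasDerivAt L (L₁ u) u)
    (hL₁ : ∀ u ∈ Ico (0 : ℝ) 1, HasDerivAt L₁ (L₂ u) u) {f : (Fin 2 → ℂ) → ℂ}
    (hf : ∀ ζ ∈ ellipsoid p,
      f ζ = ((k - c * Real.log (1 - ‖ζ 0‖ ^ 2) + L (ellipsoidRatio p ζ) : ℝ) : ℂ))
    {ζ : Fin 2 → ℂ} (hζ : ζ ∈ ellipsoid p) (i j : Fin 2) :
    wirtinger i (wirtingerBar j f) ζ =
      ellipsoidHessian p c (fun u => u * L₁ u) (fun u => L₁ u + u * L₂ u) ζ i j := by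
  have hEo := isOpen_ellipsoid hp
  -- The first derivatives `∂f/∂z̄ⱼ`, written on the whole open set so that they can be
  -- differentiated again.
  set b : Fin 2 → (Fin 2 → ℂ) → ℂ := ![
    fun ξ => (((1 - ‖ξ 0‖ ^ 2)⁻¹ *
      (c + 1 / p * (ellipsoidRatio p ξ * L₁ (ellipsoidRatio p ξ))) : ℝ) : ℂ) * ξ 0,
    fun ξ => ((ellipsoidWeight p ξ * L₁ (ellipsoidRatio p ξ) : ℝ) : ℂ) * ξ 1] with hb
  have hbar : ∀ ξ ∈ ellipsoid p, ∀ j, wirtingerBar j f ξ = b j ξ := by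
    intro ξ hξ j
    have hq := one_sub_norm_sq_pos hξ
    have h1 : HasDerivAt (fun t => k - c * Real.log t) (-(c * (1 - ‖ξ 0‖ ^ 2)⁻¹))
        (1 - ‖ξ 0‖ ^ 2) :=
      ((Real.hasDerivAt_log hq.ne').const_mul c).const_sub k
    have h2 := ((hasWirtingerAt_comp_one_sub_norm_sq h1).real_add
      ((hasWirtingerAt_ellipsoidRatio hξ).real_comp
        (hL _ (ellipsoidRatio_mem_Ico hp hξ)))).congr_of_eventuallyEq (g := f) (by
        filter_upwards [hEo.mem_nhds hξ] with η hη using hf η hη)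
    rw [h2.wirtingerBar_eq]
    fin_cases j <;> simp [hb] <;> ring
  have heq : wirtingerBar j f =ᶠ[𝓝 ζ] b j := by
    filter_upwards [hEo.mem_nhds hζ] with ξ hξ using hbar ξ hξ j
  have hq := one_sub_norm_sq_pos hζ
  have hqc : (1 - (‖ζ 0‖ : ℂ) ^ 2) ≠ 0 := by exact_mod_cast hq.ne'
  have hu := ellipsoidRatio_mem_Ico hp hζ
  have hnorm : ζ 0 * conj (ζ 0) = ((‖ζ 0‖ ^ 2 : ℝ) : ℂ) := by
    rw [Complex.mul_conj, Complex.normSq_eq_norm_sq]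
  have hnorm1 : ζ 1 * conj (ζ 1) = ((‖ζ 1‖ ^ 2 : ℝ) : ℂ) := by
    rw [Complex.mul_conj, Complex.normSq_eq_norm_sq]
  have hum : ellipsoidRatio p ζ = ‖ζ 1‖ ^ 2 * ellipsoidWeight p ζ := rfl
  have hpc : (p : ℂ) ≠ 0 := by exact_mod_cast hp.ne'
  have hratio := hasWirtingerAt_ellipsoidRatio hζ
  have hP : HasDerivAt (fun u => c + 1 / p * (u * L₁ u))
      (1 / p * (1 * L₁ (ellipsoidRatio p ζ) + ellipsoidRatio p ζ * L₂ (ellipsoidRatio p ζ)))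
      (ellipsoidRatio p ζ) :=
    (((hasDerivAt_id' _).mul (hL₁ _ hu)).const_mul (1 / p)).const_add c
  have hb0 := ((hasWirtingerAt_comp_one_sub_norm_sq (hasDerivAt_inv hq.ne')).real_mul
    (hratio.real_comp hP)).mul (hasWirtingerAt_apply 0 ζ)
  have hb1 := ((hasWirtingerAt_ellipsoidWeight hζ).real_mul
    (hratio.real_comp (hL₁ _ hu))).mul (hasWirtingerAt_apply 1 ζ)
  have hq1 : (1 - (‖ζ 0‖ : ℂ) ^ 2) * (1 - (‖ζ 0‖ : ℂ) ^ 2)⁻¹ = 1 := mul_inv_cancel₀ hqc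
  have humc : (ellipsoidRatio p ζ : ℂ) = (‖ζ 1‖ : ℂ) ^ 2 * ellipsoidWeight p ζ := by
    exact_mod_cast congrArg Complex.ofReal hum
  rw [Complex.ofReal_pow] at hnorm hnorm1
  fin_cases j
  · rw [(hb0.congr_of_eventuallyEq heq).wirtinger_eq]
    fin_cases i
    · simp only [ellipsoidHessian, Fin.zero_eta, Pi.single_eq_same, Matrix.cons_val_zero,
        Matrix.of_apply, Matrix.cons_val', Matrix.cons_val_fin_one]
      push_cast
      simp only [div_eq_mul_inv, ← inv_pow]
      linear_combination ((1 - (‖ζ 0‖ : ℂ) ^ 2)⁻¹ ^ 2 * ((p : ℂ)⁻¹ ^ 2 * ellipsoidRatio p ζ *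
        (L₁ (ellipsoidRatio p ζ) + ellipsoidRatio p ζ * L₂ (ellipsoidRatio p ζ)) +
        (c + (p : ℂ)⁻¹ * (ellipsoidRatio p ζ * L₁ (ellipsoidRatio p ζ))))) * hnorm -
        (c + (p : ℂ)⁻¹ * (ellipsoidRatio p ζ * L₁ (ellipsoidRatio p ζ))) *
          (1 - (‖ζ 0‖ : ℂ) ^ 2)⁻¹ * hq1
    · simp [ellipsoidHessian]
      ring
  · rw [(hb1.congr_of_eventuallyEq heq).wirtinger_eq]
    fin_cases i
    · simp [ellipsoidHessian]
      ring
    · simp [ellipsoidHessian]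
      linear_combination (ellipsoidWeight p ζ : ℂ) ^ 2 * L₂ (ellipsoidRatio p ζ) * hnorm1 -
        ellipsoidWeight p ζ * L₂ (ellipsoidRatio p ζ) * humc

end Potential

section Hessian

variable {p c : ℝ} {P Q : ℝ → ℝ} {ζ : Fin 2 → ℂ}

/-- Because `u = |w|² m`, the off-diagonal product cancels the `|z|² u Q` part of the diagonal
product. -/
theorem det_ellipsoidHessian (ζ : Fin 2 → ℂ) :
    (ellipsoidHessian p c P Q ζ).det =
      ((ellipsoidWeight p ζ * Q (ellipsoidRatio p ζ) / (1 - ‖ζ 0‖ ^ 2) ^ 2 *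
        (c + 1 / p * P (ellipsoidRatio p ζ)) : ℝ) : ℂ) := by
  have hnorm : ζ 0 * conj (ζ 0) = (‖ζ 0‖ : ℂ) ^ 2 := by
    rw [Complex.mul_conj, Complex.normSq_eq_norm_sq, Complex.ofReal_pow]
  have hnorm1 : ζ 1 * conj (ζ 1) = (‖ζ 1‖ : ℂ) ^ 2 := by
    rw [Complex.mul_conj, Complex.normSq_eq_norm_sq, Complex.ofReal_pow]
  have humc : (ellipsoidRatio p ζ : ℂ) = (‖ζ 1‖ : ℂ) ^ 2 * ellipsoidWeight p ζ := by
    rw [ellipsoidRatio, ellipsoidWeight]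
    push_cast
    rfl
  rw [ellipsoidHessian, Matrix.det_fin_two_of]
  push_cast
  simp only [div_eq_mul_inv, ← inv_pow]
  set u : ℂ := (ellipsoidRatio p ζ : ℂ)
  set m : ℂ := (ellipsoidWeight p ζ : ℂ)
  set K : ℂ := (Q (ellipsoidRatio p ζ) : ℂ)
  set I : ℂ := (1 - (‖ζ 0‖ : ℂ) ^ 2)⁻¹
  linear_combination (-(p : ℂ)⁻¹ ^ 2 * m ^ 2 * K ^ 2 * I ^ 2) * (ζ 1 * conj (ζ 1) * hnorm +
    (‖ζ 0‖ : ℂ) ^ 2 * hnorm1) + (p : ℂ)⁻¹ ^ 2 * m * K ^ 2 * I ^ 2 * (‖ζ 0‖ : ℂ) ^ 2 * humc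

/-- Completing the square: the matrix is `B * diagonal d * Bᴴ` with `B` unipotent and `d` positive.
-/
theorem posDef_ellipsoidHessian (hζ : ζ ∈ ellipsoid p) (hQ : 0 < Q (ellipsoidRatio p ζ))
    (hP : 0 < c + 1 / p * P (ellipsoidRatio p ζ)) : (ellipsoidHessian p c P Q ζ).PosDef := by
  have hq := one_sub_norm_sq_pos hζ
  have hm := ellipsoidWeight_pos hζ
  set y : ℂ := ((1 / p / (1 - ‖ζ 0‖ ^ 2) : ℝ) : ℂ) * conj (ζ 0) * ζ 1 with hy
  set B : Matrix (Fin 2) (Fin 2) ℂ := !![1, y; 0, 1] with hB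
  set d : Fin 2 → ℂ := ![(((c + 1 / p * P (ellipsoidRatio p ζ)) / (1 - ‖ζ 0‖ ^ 2) ^ 2 : ℝ) : ℂ),
    ((ellipsoidWeight p ζ * Q (ellipsoidRatio p ζ) : ℝ) : ℂ)] with hd
  have hD : (Matrix.diagonal d).PosDef := by
    refine Matrix.PosDef.diagonal fun i => ?_
    fin_cases i
    · exact Complex.zero_lt_real.2 (by positivity)
    · exact Complex.zero_lt_real.2 (by positivity)
  have hBi : Function.Injective B.vecMul := by
    refine Matrix.vecMul_injective_of_isUnit ?_
    rw [Matrix.isUnit_iff_isUnit_det, hB, Matrix.det_fin_two_of]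
    simp
  have h := hD.mul_mul_conjTranspose_same hBi
  convert h using 1
  have hnorm : ζ 0 * conj (ζ 0) = (‖ζ 0‖ : ℂ) ^ 2 := by
    rw [Complex.mul_conj, Complex.normSq_eq_norm_sq, Complex.ofReal_pow]
  have hnorm1 : ζ 1 * conj (ζ 1) = (‖ζ 1‖ : ℂ) ^ 2 := by
    rw [Complex.mul_conj, Complex.normSq_eq_norm_sq, Complex.ofReal_pow]
  have humc : (ellipsoidRatio p ζ : ℂ) = (‖ζ 1‖ : ℂ) ^ 2 * ellipsoidWeight p ζ := by
    rw [ellipsoidRatio, ellipsoidWeight]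
    push_cast
    rfl
  ext i j
  fin_cases i <;> fin_cases j <;>
    simp only [ellipsoidHessian, hB, hd, hy, Matrix.mul_apply, Fin.sum_univ_two,
      Matrix.conjTranspose_apply, Matrix.diagonal_apply, Matrix.of_apply, Matrix.cons_val',
      Matrix.cons_val_zero, Matrix.cons_val_one, Matrix.cons_val_fin_one, Fin.zero_eta,
      Fin.mk_one, Fin.isValue, RCLike.star_def, map_one, map_zero, map_mul, Complex.conj_conj,
      Complex.conj_ofReal, if_true, zero_ne_one, one_ne_zero, if_false, mul_zero, zero_mul,
      add_zero, zero_add, one_mul, mul_one]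
  · push_cast
    simp only [div_eq_mul_inv, ← inv_pow]
    set u : ℂ := (ellipsoidRatio p ζ : ℂ)
    set m : ℂ := (ellipsoidWeight p ζ : ℂ)
    set K : ℂ := (Q (ellipsoidRatio p ζ) : ℂ)
    set I : ℂ := (1 - (‖ζ 0‖ : ℂ) ^ 2)⁻¹
    linear_combination (-(p : ℂ)⁻¹ ^ 2 * m * K * I ^ 2) * (ζ 1 * conj (ζ 1) * hnorm +
      (‖ζ 0‖ : ℂ) ^ 2 * hnorm1) + (p : ℂ)⁻¹ ^ 2 * K * I ^ 2 * (‖ζ 0‖ : ℂ) ^ 2 * humc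
  · push_cast
    ring
  · push_cast
    ring

end Hessian

/-! ### The one-variable profile of the Bergman potential -/

section Profile

variable {p u : ℝ}

/-- The first derivative of `log ((1 + p) + (1 - p) u) - 3 log (1 - u)`. -/
noncomputable def profileDeriv (p u : ℝ) : ℝ := (1 - p) / ((1 + p) + (1 - p) * u) + 3 / (1 - u)

/-- The second derivative of `log ((1 + p) + (1 - p) u) - 3 log (1 - u)`. -/
noncomputable def profileDeriv₂ (p u : ℝ) : ℝ :=
  -(1 - p) ^ 2 / ((1 + p) + (1 - p) * u) ^ 2 + 3 / (1 - u) ^ 2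

/-- The third derivative of `log ((1 + p) + (1 - p) u) - 3 log (1 - u)`. -/
noncomputable def profileDeriv₃ (p u : ℝ) : ℝ :=
  2 * (1 - p) ^ 3 / ((1 + p) + (1 - p) * u) ^ 3 + 6 / (1 - u) ^ 3

theorem profile_pos (hp : 0 < p) (hu : u ∈ Ico (0 : ℝ) 1) : 0 < (1 + p) + (1 - p) * u := by
  nlinarith [hu.1, hu.2]

theorem hasDerivAt_profile_base (p u : ℝ) :
    HasDerivAt (fun u => (1 + p) + (1 - p) * u) (1 - p) u := by
  simpa using ((hasDerivAt_id' u).const_mul (1 - p)).const_add (1 + p)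

theorem hasDerivAt_one_sub (u : ℝ) : HasDerivAt (fun u : ℝ => 1 - u) (-1) u :=
  (hasDerivAt_id' u).const_sub 1

theorem hasDerivAt_profile (hp : 0 < p) (hu : u ∈ Ico (0 : ℝ) 1) :
    HasDerivAt (fun u => Real.log ((1 + p) + (1 - p) * u) - 3 * Real.log (1 - u))
      (profileDeriv p u) u := by
  have h0 := (profile_pos hp hu).ne'
  have h1 : 1 - u ≠ 0 := by linarith [hu.2]
  refine (((hasDerivAt_profile_base p u).log h0).sub
    (((hasDerivAt_one_sub u).log h1).const_mul 3)).congr_deriv ?_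
  rw [profileDeriv]
  ring

theorem hasDerivAt_profileDeriv (hp : 0 < p) (hu : u ∈ Ico (0 : ℝ) 1) :
    HasDerivAt (profileDeriv p) (profileDeriv₂ p u) u := by
  have h0 := (profile_pos hp hu).ne'
  have h1 : 1 - u ≠ 0 := by linarith [hu.2]
  refine (((hasDerivAt_const u (1 - p)).div (hasDerivAt_profile_base p u) h0).add
    ((hasDerivAt_const u 3).div (hasDerivAt_one_sub u) h1)).congr_deriv ?_
  rw [profileDeriv₂]
  ring

theorem hasDerivAt_profileDeriv₂ (hp : 0 < p) (hu : u ∈ Ico (0 : ℝ) 1) :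
    HasDerivAt (profileDeriv₂ p) (profileDeriv₃ p u) u := by
  have h0 := (profile_pos hp hu).ne'
  have h1 : 1 - u ≠ 0 := by linarith [hu.2]
  refine (((hasDerivAt_const u (-(1 - p) ^ 2)).div ((hasDerivAt_profile_base p u).pow 2)
    (pow_ne_zero 2 h0)).add ((hasDerivAt_const u 3).div ((hasDerivAt_one_sub u).pow 2)
    (pow_ne_zero 2 h1))).congr_deriv ?_
  simp only [profileDeriv₃, Pi.pow_apply]
  field_simp
  ring

theorem differentiableAt_profileDeriv₃ (hp : 0 < p) (hu : u ∈ Ico (0 : ℝ) 1) :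
    DifferentiableAt ℝ (profileDeriv₃ p) u := by
  have h0 := (profile_pos hp hu).ne'
  have h1 : 1 - u ≠ 0 := by linarith [hu.2]
  exact ((differentiableAt_const _).div ((hasDerivAt_profile_base p u).differentiableAt.pow 3)
    (pow_ne_zero 3 h0)).add ((differentiableAt_const _).div
    ((hasDerivAt_one_sub u).differentiableAt.pow 3) (pow_ne_zero 3 h1))

/-- `P(u) = u L'(u)` for the Bergman potential of the ellipsoid. -/
noncomputable def profileP (p u : ℝ) : ℝ := u * profileDeriv p u

/-- `Q(u) = P'(u)` for the Bergman potential of the ellipsoid. -/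
noncomputable def profileQ (p u : ℝ) : ℝ := profileDeriv p u + u * profileDeriv₂ p u

theorem profileP_nonneg (hp : 0 < p) (hu : u ∈ Ico (0 : ℝ) 1) : 0 ≤ profileP p u := by
  have h0 := profile_pos hp hu
  have h1 : 0 < 1 - u := by linarith [hu.2]
  refine mul_nonneg hu.1 ?_
  have : profileDeriv p u = ((1 - p) * (1 - u) + 3 * ((1 + p) + (1 - p) * u)) /
      (((1 + p) + (1 - p) * u) * (1 - u)) := by
    rw [profileDeriv]; field_simp
  rw [this]
  refine div_nonneg ?_ (by positivity)
  nlinarith [hu.1, hu.2, mul_nonneg hp.le h1.le]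

theorem profileQ_pos (hp : 0 < p) (hu : u ∈ Ico (0 : ℝ) 1) : 0 < profileQ p u := by
  have h0 := profile_pos hp hu
  have h1 : 0 < 1 - u := by linarith [hu.2]
  have : profileQ p u = ((1 - p) * (1 + p) * (1 - u) ^ 2 +
      3 * ((1 + p) + (1 - p) * u) ^ 2) / (((1 + p) + (1 - p) * u) ^ 2 * (1 - u) ^ 2) := by
    rw [profileQ, profileDeriv, profileDeriv₂]; field_simp; ring
  rw [this]
  refine div_pos ?_ (by positivity)
  -- The difference of the two sides is `1 + u`. Squaring absorbs the possibly negative term `-p² (1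
  -- - u)²` of the numerator.
  have h2 : p * (1 - u) < (1 + p) + (1 - p) * u := by nlinarith [hu.1]
  have h3 : (p * (1 - u)) ^ 2 < ((1 + p) + (1 - p) * u) ^ 2 :=
    pow_lt_pow_left₀ h2 (by positivity) two_ne_zero
  nlinarith [sq_nonneg (1 - u), sq_nonneg ((1 + p) + (1 - p) * u)]

theorem profile_coeff_pos (hp : 0 < p) (hu : u ∈ Ico (0 : ℝ) 1) :
    0 < (2 + 1 / p) + 1 / p * profileP p u := by
  have := profileP_nonneg hp hu
  positivity

theorem hasDerivAt_profileP (hp : 0 < p) (hu : u ∈ Ico (0 : ℝ) 1) :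
    HasDerivAt (profileP p) (profileQ p u) u := by
  refine ((hasDerivAt_id' u).mul (hasDerivAt_profileDeriv hp hu)).congr_deriv ?_
  rw [profileQ, one_mul]

theorem hasDerivAt_profileQ (hp : 0 < p) (hu : u ∈ Ico (0 : ℝ) 1) :
    HasDerivAt (profileQ p) (2 * profileDeriv₂ p u + u * profileDeriv₃ p u) u := by
  refine ((hasDerivAt_profileDeriv hp hu).add
    ((hasDerivAt_id' u).mul (hasDerivAt_profileDeriv₂ hp hu))).congr_deriv ?_
  ring

/-- The derivative of `log Q + log (2 + 1 / p + P / p)`. -/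
noncomputable def logDetDeriv (p u : ℝ) : ℝ :=
  (2 * profileDeriv₂ p u + u * profileDeriv₃ p u) / profileQ p u +
    1 / p * profileQ p u / ((2 + 1 / p) + 1 / p * profileP p u)

theorem hasDerivAt_logDet (hp : 0 < p) (hu : u ∈ Ico (0 : ℝ) 1) :
    HasDerivAt (fun u => Real.log (profileQ p u) +
      Real.log ((2 + 1 / p) + 1 / p * profileP p u)) (logDetDeriv p u) u :=
  ((hasDerivAt_profileQ hp hu).log (profileQ_pos hp hu).ne').add
    ((((hasDerivAt_profileP hp hu).const_mul (1 / p)).const_add (2 + 1 / p)).log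
      (profile_coeff_pos hp hu).ne')

theorem differentiableAt_logDetDeriv (hp : 0 < p) (hu : u ∈ Ico (0 : ℝ) 1) :
    DifferentiableAt ℝ (logDetDeriv p) u := by
  have h2 := (hasDerivAt_profileDeriv₂ hp hu).differentiableAt
  have h3 := differentiableAt_profileDeriv₃ hp hu
  have hQ := (hasDerivAt_profileQ hp hu).differentiableAt
  have hP := (hasDerivAt_profileP hp hu).differentiableAt
  exact (((h2.const_mul 2).add (differentiableAt_id.mul h3)).div hQ (profileQ_pos hp hu).ne').add
    ((hQ.const_mul (1 / p)).div ((hP.const_mul (1 / p)).const_add _)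
      (profile_coeff_pos hp hu).ne')

theorem logDetDeriv_zero_div (hp : 0 < p) : logDetDeriv p 0 / profileQ p 0 =
    (2 * p ^ 3 + 10 * p ^ 2 + 10 * p + 5) / ((p + 2) ^ 2 * (2 * p + 1)) := by
  have h1 : 1 + p ≠ 0 := by positivity
  have h2 : p + 2 ≠ 0 := by positivity
  have h3 : 2 * p + 1 ≠ 0 := by positivity
  have hQ : profileQ p 0 = (2 * (p + 2)) / (1 + p) := by
    simp only [profileQ, profileDeriv, mul_zero, zero_mul, add_zero, sub_zero, div_one]
    field_simp
    ring
  have hP : profileP p 0 = 0 := zero_mul _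
  have hD : profileDeriv₂ p 0 = 3 - (1 - p) ^ 2 / (1 + p) ^ 2 := by
    simp only [profileDeriv₂, mul_zero, add_zero, sub_zero, one_pow, div_one]
    ring
  have hC : 2 + 1 / p = (2 * p + 1) / p := by field_simp
  rw [logDetDeriv, hP, hQ, hD, mul_zero, add_zero, zero_mul, add_zero, hC]
  field_simp
  ring

end Profile

/-! ### Metric, Ricci tensor and failure of the Einstein condition -/

section BergmanMetricEllipsoid

variable {p : ℝ} {ζ : Fin 2 → ℂ}

theorem bergmanKernel_ellipsoid_pos (hp : 0 < p) (hζ : ζ ∈ ellipsoid p) :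
    0 < bergmanKernel (ellipsoid p) ζ := by
  have hu := ellipsoidRatio_mem_Ico hp hζ
  have hN := profile_pos hp hu
  have h1 : 0 < 1 - ellipsoidRatio p ζ := sub_pos.2 hu.2
  have hq := Real.rpow_pos_of_pos (one_sub_norm_sq_pos hζ) (-(2 + 1 / p))
  rw [bergmanKernel_ellipsoid hp hζ]
  positivity

/-- The closed form involves `|w|²` rather than `|w| ^ (2p)`, so it is smooth across `w = 0` for
every `p`. -/
theorem contDiffOn_bergmanKernel_ellipsoid (hp : 0 < p) :
    ContDiffOn ℝ ∞ (bergmanKernel (ellipsoid p)) (ellipsoid p) := by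
  refine ContDiffOn.congr ?_ fun ζ hζ => bergmanKernel_ellipsoid hp hζ
  have hn : ∀ i : Fin 2, ContDiffOn ℝ ∞ (fun ζ : Fin 2 → ℂ => ‖ζ i‖ ^ 2) (ellipsoid p) :=
    fun i => ((contDiff_apply ℝ ℂ i).norm_sq ℝ).contDiffOn
  have hq : ContDiffOn ℝ ∞ (fun ζ : Fin 2 → ℂ => 1 - ‖ζ 0‖ ^ 2) (ellipsoid p) :=
    contDiffOn_const.sub (hn 0)
  have hq0 : ∀ ζ ∈ ellipsoid p, 1 - ‖ζ 0‖ ^ 2 ≠ 0 := fun ζ hζ => (one_sub_norm_sq_pos hζ).ne'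
  have hu : ContDiffOn ℝ ∞ (ellipsoidRatio p) (ellipsoid p) :=
    (hn 1).mul (hq.rpow_const_of_ne hq0)
  refine (contDiffOn_const.mul (hq.rpow_const_of_ne hq0)).mul
    ((contDiffOn_const.add (contDiffOn_const.mul hu)).div ((contDiffOn_const.sub hu).pow 3)
      fun ζ hζ => pow_ne_zero 3 (sub_pos.2 (ellipsoidRatio_lt_one hp hζ)).ne')

theorem log_bergmanKernel_ellipsoid (hp : 0 < p) (hζ : ζ ∈ ellipsoid p) :
    Real.log (bergmanKernel (ellipsoid p) ζ) =
      Real.log (1 / (Real.pi ^ 2 * p)) - (2 + 1 / p) * Real.log (1 - ‖ζ 0‖ ^ 2) +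
        (Real.log ((1 + p) + (1 - p) * ellipsoidRatio p ζ) -
          3 * Real.log (1 - ellipsoidRatio p ζ)) := by
  have hu := ellipsoidRatio_mem_Ico hp hζ
  have hN := profile_pos hp hu
  have h1 : 0 < 1 - ellipsoidRatio p ζ := sub_pos.2 hu.2
  have hq := one_sub_norm_sq_pos hζ
  have hq' := Real.rpow_pos_of_pos hq (-(2 + 1 / p))
  have hk : 0 < 1 / (Real.pi ^ 2 * p) := by positivity
  rw [bergmanKernel_ellipsoid hp hζ, Real.log_mul (by positivity) (by positivity),
    Real.log_mul hk.ne' hq'.ne', Real.log_rpow hq, Real.log_div hN.ne' (by positivity),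
    Real.log_pow]
  push_cast
  ring

theorem bergmanMetric_ellipsoid (hp : 0 < p) (hζ : ζ ∈ ellipsoid p) :
    bergmanMetric (ellipsoid p) ζ =
      ellipsoidHessian p (2 + 1 / p) (profileP p) (profileQ p) ζ := by
  ext i j
  exact wirtinger_wirtingerBar_potential hp (fun u hu => hasDerivAt_profile hp hu)
    (fun u hu => hasDerivAt_profileDeriv hp hu)
    (fun η hη => congrArg Complex.ofReal (log_bergmanKernel_ellipsoid hp hη)) hζ i j

theorem posDef_bergmanMetric_ellipsoid (hp : 0 < p) (hζ : ζ ∈ ellipsoid p) :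
    (bergmanMetric (ellipsoid p) ζ).PosDef := by
  have hu := ellipsoidRatio_mem_Ico hp hζ
  rw [bergmanMetric_ellipsoid hp hζ]
  exact posDef_ellipsoidHessian hζ (profileQ_pos hp hu) (profile_coeff_pos hp hu)

/-- The weight contributes `-(1/p) log q` and the denominator `-2 log q`, which reproduces the
coefficient `2 + 1/p` of `log K`. The determinant is a positive real, so the complex logarithm is
the real one. -/
theorem log_det_bergmanMetric_ellipsoid (hp : 0 < p) (hζ : ζ ∈ ellipsoid p) :
    Complex.log (bergmanMetric (ellipsoid p) ζ).det =
      ((0 - (2 + 1 / p) * Real.log (1 - ‖ζ 0‖ ^ 2) +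
        (Real.log (profileQ p (ellipsoidRatio p ζ)) +
          Real.log ((2 + 1 / p) + 1 / p * profileP p (ellipsoidRatio p ζ))) : ℝ) : ℂ) := by
  have hu := ellipsoidRatio_mem_Ico hp hζ
  have hq := one_sub_norm_sq_pos hζ
  have hm := ellipsoidWeight_pos hζ
  have hQ := profileQ_pos hp hu
  have hP := profile_coeff_pos hp hu
  rw [bergmanMetric_ellipsoid hp hζ, det_ellipsoidHessian, ← Complex.ofReal_log (by positivity),
    Real.log_mul (by positivity) hP.ne', Real.log_div (by positivity) (by positivity),
    Real.log_mul hm.ne' hQ.ne', Real.log_pow, ellipsoidWeight, Real.log_rpow hq]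
  congr 1
  push_cast
  ring

/-- The derivative of `logDetDeriv` can stay unevaluated: it carries a factor `u`, which is zero on
`w = 0`. -/
theorem ricci_bergmanMetric_ellipsoid (hp : 0 < p) (hζ : ζ ∈ ellipsoid p) :
    ricci (bergmanMetric (ellipsoid p)) ζ =
      -ellipsoidHessian p (2 + 1 / p) (fun u => u * logDetDeriv p u)
        (fun u => logDetDeriv p u + u * deriv (logDetDeriv p) u) ζ := by
  ext i j
  exact congrArg Neg.neg (wirtinger_wirtingerBar_potential hp
    (fun u hu => hasDerivAt_logDet hp hu)
    (fun u hu => (differentiableAt_logDetDeriv hp hu).hasDerivAt)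
    (fun η hη => log_det_bergmanMetric_ellipsoid hp hη) hζ i j)

theorem ellipsoidRatio_eq_zero (hζ : ζ 1 = 0) : ellipsoidRatio p ζ = 0 := by
  simp [ellipsoidRatio, hζ]

theorem ricci_zero_zero (hp : 0 < p) (hζ : ζ ∈ ellipsoid p) (h0 : ζ 1 = 0) :
    ricci (bergmanMetric (ellipsoid p)) ζ 0 0 = -bergmanMetric (ellipsoid p) ζ 0 0 := by
  rw [ricci_bergmanMetric_ellipsoid hp hζ, bergmanMetric_ellipsoid hp hζ]
  simp [ellipsoidHessian, ellipsoidRatio_eq_zero h0, profileP]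

/-- The ratio `Ric₂₂ / g₂₂` of the Bergman metric of the ellipsoid along `w = 0`. -/
noncomputable def ricciRatio (p : ℝ) : ℝ :=
  -((2 * p ^ 3 + 10 * p ^ 2 + 10 * p + 5) / ((p + 2) ^ 2 * (2 * p + 1)))

theorem ricci_one_one (hp : 0 < p) (hζ : ζ ∈ ellipsoid p) (h0 : ζ 1 = 0) :
    ricci (bergmanMetric (ellipsoid p)) ζ 1 1 =
      (ricciRatio p : ℂ) * bergmanMetric (ellipsoid p) ζ 1 1 := by
  have hQ := (profileQ_pos hp (u := 0) ⟨le_rfl, one_pos⟩).ne'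
  have h : logDetDeriv p 0 = -ricciRatio p * profileQ p 0 := by
    rw [ricciRatio, neg_neg, ← logDetDeriv_zero_div hp, div_mul_cancel₀ _ hQ]
  rw [ricci_bergmanMetric_ellipsoid hp hζ, bergmanMetric_ellipsoid hp hζ]
  simp only [ellipsoidHessian, ellipsoidRatio_eq_zero h0, h, zero_mul, add_zero,
    Matrix.neg_apply, Matrix.of_apply, Matrix.cons_val', Matrix.cons_val_one,
    Matrix.cons_val_fin_one]
  push_cast
  ring

/-- Numerator minus denominator of the fraction is `(p - 1)²`. -/
theorem neg_one_eq_ricciRatio_iff (hp : 0 < p) : -1 = ricciRatio p ↔ p = 1 := by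
  have h : (p + 2) ^ 2 * (2 * p + 1) ≠ 0 := by positivity
  rw [ricciRatio, neg_inj, eq_div_iff h]
  constructor
  · intro h1
    have h2 : (p - 1) ^ 2 = 0 := by linarith
    exact sub_eq_zero.1 (pow_eq_zero_iff two_ne_zero |>.1 h2)
  · rintro rfl
    norm_num

theorem hermVal_single {n : ℕ} (H : Matrix (Fin n) (Fin n) ℂ) (i : Fin n) :
    hermVal H (Pi.single i 1) = H i i := by
  rw [hermVal, Finset.sum_eq_single i, Finset.sum_eq_single i]
  · simp
  · intro j _ hj
    simp [hj]
  · simp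
  · intro j _ hj
    simp [hj]
  · simp

theorem real_mem_ellipsoid (hp : 0 < p) {x : ℝ} (h0 : 0 ≤ x) (h1 : x < 1) :
    ![(x : ℂ), 0] ∈ ellipsoid p := by
  have h : (0 : ℝ) ^ (2 * p) = 0 := Real.zero_rpow (by positivity)
  simp only [ellipsoid, mem_ofPred_eq, Matrix.cons_val_zero, Matrix.cons_val_one,
    Matrix.cons_val_fin_one, norm_zero, h, Complex.norm_real, Real.norm_eq_abs, sq_abs]
  nlinarith

/-- Otherwise the closed set `C` would contain the limit `(1, 0)` of the segment, which lies outside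
the ellipsoid. -/
theorem exists_real_notMem_of_isCompact (hp : 0 < p) {C : Set (Fin 2 → ℂ)} (hC : IsCompact C)
    (hCE : C ⊆ ellipsoid p) : ∃ x : ℝ, ![(x : ℂ), 0] ∈ ellipsoid p \ C := by
  by_contra! h
  have hmem : ∀ x ∈ Ico (0 : ℝ) 1, ![(x : ℂ), 0] ∈ C := fun x hx => by
    by_contra hxC
    exact h x ⟨real_mem_ellipsoid hp hx.1 hx.2, hxC⟩
  have hcont : Continuous fun x : ℝ => (![(x : ℂ), 0] : Fin 2 → ℂ) := by
    refine continuous_pi fun i => ?_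
    fin_cases i
    · exact Complex.continuous_ofReal
    · exact continuous_const
  have hcl : closure (Ico (0 : ℝ) 1) ⊆ (fun x : ℝ => (![(x : ℂ), 0] : Fin 2 → ℂ)) ⁻¹' C :=
    closure_minimal hmem (hC.isClosed.preimage hcont)
  rw [closure_Ico zero_ne_one] at hcl
  have h1 := norm_zero_lt_one_of_mem_ellipsoid (hCE (hcl ⟨zero_le_one, le_rfl⟩))
  simp at h1

theorem bergmanMetric_ellipsoid_diag_ne_zero (hp : 0 < p) (hζ : ζ ∈ ellipsoid p) (i : Fin 2) :
    bergmanMetric (ellipsoid p) ζ i i ≠ 0 :=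
  ((posDef_bergmanMetric_ellipsoid hp hζ).diag_pos).ne'

theorem not_isKaehlerEinstein_ellipsoid (hp : 0 < p) (h1 : p ≠ 1) :
    ¬ IsKaehlerEinstein (ellipsoid p) (bergmanMetric (ellipsoid p)) := by
  rintro ⟨c, hc⟩
  have hζ := real_mem_ellipsoid hp le_rfl one_pos
  have h := hc _ hζ
  have h00 := congrFun (congrFun h 0) 0
  have h11 := congrFun (congrFun h 1) 1
  rw [ricci_zero_zero hp hζ rfl, ← neg_one_mul] at h00
  rw [ricci_one_one hp hζ rfl] at h11
  have e0 := mul_right_cancel₀ (bergmanMetric_ellipsoid_diag_ne_zero hp hζ 0) h00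
  have e1 := mul_right_cancel₀ (bergmanMetric_ellipsoid_diag_ne_zero hp hζ 1) h11
  refine h1 ((neg_one_eq_ricciRatio_iff hp).1 ?_)
  exact_mod_cast e0.trans e1.symm

/-- Testing on the two coordinate vectors at a point of `w = 0` outside `C` puts `c` within `ε` of
both ratios. These do not depend on the point, so they coincide. -/
theorem not_isAsymptoticallyKaehlerEinstein_ellipsoid (hp : 0 < p) (h1 : p ≠ 1) :
    ¬ IsAsymptoticallyKaehlerEinstein (ellipsoid p) (bergmanMetric (ellipsoid p)) := by
  rintro ⟨c, hc⟩
  have key : ∀ ε : ℝ, 0 < ε → |-1 - c| ≤ ε ∧ |ricciRatio p - c| ≤ ε := by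
    intro ε hε
    obtain ⟨C, hC, hCE, h⟩ := hc ε hε
    obtain ⟨x, hx⟩ := exists_real_notMem_of_isCompact hp hC hCE
    have hb : ∀ (i : Fin 2) (r : ℝ), ricci (bergmanMetric (ellipsoid p)) ![(x : ℂ), 0] i i =
        (r : ℂ) * bergmanMetric (ellipsoid p) ![(x : ℂ), 0] i i → |r - c| ≤ ε := by
      intro i r hr
      have h2 := h _ hx (Pi.single i 1)
      rw [hermVal_single, hermVal_single, hr, ← sub_mul, norm_mul] at h2
      have h3 := le_of_mul_le_mul_right h2
        (norm_pos_iff.2 (bergmanMetric_ellipsoid_diag_ne_zero hp hx.1 i))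
      rwa [← Complex.ofReal_sub, Complex.norm_real] at h3
    refine ⟨hb 0 (-1) ?_, hb 1 _ (ricci_one_one hp hx.1 rfl)⟩
    rw [ricci_zero_zero hp hx.1 rfl]
    simp
  have e0 : -1 - c = 0 := abs_nonpos_iff.1 (le_of_forall_pos_le_add fun ε hε => by
    simpa using (key ε hε).1)
  have e1 : ricciRatio p - c = 0 := abs_nonpos_iff.1 (le_of_forall_pos_le_add fun ε hε => by
    simpa using (key ε hε).2)
  exact h1 ((neg_one_eq_ricciRatio_iff hp).1 (by linarith))

end BergmanMetricEllipsoid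

end BergmanKernel

theorem mainTheorem9 (p : ℝ) (hp : 0 < p) :
    -- the Bergman kernel and the Bergman metric are well defined on `E = E(1,1,p)`
    ContDiffOn ℝ ∞ (bergmanKernel (ellipsoid p)) (ellipsoid p) ∧
    (∀ ζ ∈ ellipsoid p, 0 < bergmanKernel (ellipsoid p) ζ) ∧
    (∀ ζ ∈ ellipsoid p, (bergmanMetric (ellipsoid p) ζ).PosDef) ∧
    -- the two ratios at the points of `E` with `z = x` real and `w = 0`
    (∀ x : ℝ, ![(x : ℂ), 0] ∈ ellipsoid p →
      ricci (bergmanMetric (ellipsoid p)) ![(x : ℂ), 0] 0 0 /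
          bergmanMetric (ellipsoid p) ![(x : ℂ), 0] 0 0 = -1 ∧
      ricci (bergmanMetric (ellipsoid p)) ![(x : ℂ), 0] 1 1 /
          bergmanMetric (ellipsoid p) ![(x : ℂ), 0] 1 1 =
        ((-((2 * p ^ 3 + 10 * p ^ 2 + 10 * p + 5) / ((p + 2) ^ 2 * (2 * p + 1))) : ℝ) : ℂ) ∧
      (ricci (bergmanMetric (ellipsoid p)) ![(x : ℂ), 0] 0 0 /
          bergmanMetric (ellipsoid p) ![(x : ℂ), 0] 0 0 =
        ricci (bergmanMetric (ellipsoid p)) ![(x : ℂ), 0] 1 1 /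
          bergmanMetric (ellipsoid p) ![(x : ℂ), 0] 1 1 ↔ p = 1)) ∧
    -- the failure of the (asymptotic) Kähler–Einstein property
    (p ≠ 1 →
      ¬ IsKaehlerEinstein (ellipsoid p) (bergmanMetric (ellipsoid p)) ∧
      ¬ IsAsymptoticallyKaehlerEinstein (ellipsoid p) (bergmanMetric (ellipsoid p))) := by
  refine ⟨contDiffOn_bergmanKernel_ellipsoid hp, fun ζ => bergmanKernel_ellipsoid_pos hp,
    fun ζ => posDef_bergmanMetric_ellipsoid hp, fun x hx => ?_, fun h1 =>
      ⟨not_isKaehlerEinstein_ellipsoid hp h1, not_isAsymptoticallyKaehlerEinstein_ellipsoid hp h1⟩⟩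
  have h0 : ricci (bergmanMetric (ellipsoid p)) ![(x : ℂ), 0] 0 0 /
      bergmanMetric (ellipsoid p) ![(x : ℂ), 0] 0 0 = -1 := by
    rw [ricci_zero_zero hp hx rfl, neg_div,
      div_self (bergmanMetric_ellipsoid_diag_ne_zero hp hx 0)]
  have h1 : ricci (bergmanMetric (ellipsoid p)) ![(x : ℂ), 0] 1 1 /
      bergmanMetric (ellipsoid p) ![(x : ℂ), 0] 1 1 = (ricciRatio p : ℂ) := by
    rw [ricci_one_one hp hx rfl,
      mul_div_cancel_right₀ _ (bergmanMetric_ellipsoid_diag_ne_zero hp hx 1)]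
  refine ⟨h0, h1, ?_⟩
  rw [h0, h1, ← neg_one_eq_ricciRatio_iff hp]
  exact_mod_cast Iff.rfl
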